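/- **Theorem (uniqueness of blow-ups at singular points).** Let $\Omega\subset\mathbb R^n$ be open and let $u\in C^{1,1}_{\rm loc}(\Omega)$ satisfy $$\Delta u=\chi_{\{u>0\}}\ \text{ a.e. in }\Omega,\qquad u\ge 0\ \text{ in }\Omega .$$ Let $$\mathcal P:=\Bigl\{p(x)=\tfrac12\langle Ax,x\rangle\ :\ A\in\mathbb R^{n\times n}\text{ symmetric, nonnegative definite, } \operatorname{tr}A=1\Bigr\},$$ and let $\Sigma$ be the set of singular points of $u$, i.e. of the points $x_0\in\partial\{u>0\}\cap\Omega$ for which there are radii $r_k>0$, $r_k\to0$, and some $p\in\mathcal P$ such that $\frac{u(x_0+r_kx)}{r_k^2}\to p(x)$ for every $x\in\mathbb R^n$. Then for every $x_0\in\Sigma$ there exists $p_{*,x_0}\in\mathcal P$ such that $$\lim_{r\to0^+}\frac{u(x_0+rx)}{r^2}=p_{*,x_0}(x)$$ in $C^1_{\rm loc}(\mathbb R^n)$, without passing to a subsequence. In addition, the map $\Sigma\ni x_0\mapsto p_{*,x_0}$ is locally uniformly continuous: for every compact $K\subset\Omega$ and every $\varepsilon>0$ there is $\delta>0$ such that $$\sup_{|z|\le1}\,\bigl|p_{*,x_0}(z)-p_{*,x_1}(z)\bigr|\le\varepsilon\qquad\text{for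 all }x_0,x_1\in\Sigma\cap K\text{ with }|x_0-x_1|<\delta .$$ -/

import Mathlib

open Set Filter Topology MeasureTheory
open scoped Laplacian

/-- `u` is of class `C^{1,1}_loc` in the open set `Ω` and solves `Δ u = χ_{u > 0}` and `u ≥ 0`
in `Ω`.  Since the derivative of `u` is locally Lipschitz in `Ω`, `u` is twice differentiable at
almost every point of `Ω` and the equation is imposed almost everywhere. -/
structure IsObstacleSolution {n : ℕ} (Ω : Set (EuclideanSpace ℝ (Fin n)))
    (u : EuclideanSpace ℝ (Fin n) → ℝ) : Prop where
  differentiableOn : DifferentiableOn ℝ u Ω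
  locallyLipschitzOn_fderiv : LocallyLipschitzOn Ω (fderiv ℝ u)
  nonneg : ∀ x ∈ Ω, 0 ≤ u x
  laplacian_eq : ∀ᵐ x ∂(volume : Measure (EuclideanSpace ℝ (Fin n))),
    x ∈ Ω → (Δ u) x = {y | 0 < u y}.indicator (fun _ => (1 : ℝ)) x

/-- The free boundary `∂{u > 0} ∩ Ω`. -/
def freeBoundary {n : ℕ} (Ω : Set (EuclideanSpace ℝ (Fin n)))
    (u : EuclideanSpace ℝ (Fin n) → ℝ) : Set (EuclideanSpace ℝ (Fin n)) :=
  Ω ∩ frontier {x | x ∈ Ω ∧ 0 < u x}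

/-- The rescaling `x ↦ u (x₀ + r x) / r ^ 2`. -/
noncomputable def rescaling {n : ℕ} (u : EuclideanSpace ℝ (Fin n) → ℝ)
    (x₀ : EuclideanSpace ℝ (Fin n)) (r : ℝ) (x : EuclideanSpace ℝ (Fin n)) : ℝ :=
  u (x₀ + r • x) / r ^ 2

/-- The quadratic polynomial `x ↦ ½ ⟨A x, x⟩`. -/
noncomputable def quadraticPoly {n : ℕ} (A : Matrix (Fin n) (Fin n) ℝ)
    (x : EuclideanSpace ℝ (Fin n)) : ℝ :=
  (1 / 2 : ℝ) * ((A.mulVec x.ofLp) ⬝ᵥ x.ofLp)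

/-- The set `𝒫` of the polynomials `½ ⟨A x, x⟩` with `A` symmetric, nonnegative definite and of
trace one. -/
def blowupPolynomials (n : ℕ) : Set (EuclideanSpace ℝ (Fin n) → ℝ) :=
  {p | ∃ A : Matrix (Fin n) (Fin n) ℝ, A.PosSemidef ∧ A.trace = 1 ∧ p = quadraticPoly A}

/-- The singular set `Σ`: the free boundary points at which, along some sequence of radii
tending to zero, the rescalings converge to an element of `𝒫`.  Pointwise convergence is
required here; for the solutions considered it is the same as `C^1_loc` convergence, because the
second derivatives of the rescalings are locally bounded. -/
def singularSet {n : ℕ} (Ω : Set (EuclideanSpace ℝ (Fin n)))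
    (u : EuclideanSpace ℝ (Fin n) → ℝ) : Set (EuclideanSpace ℝ (Fin n)) :=
  {x₀ | x₀ ∈ freeBoundary Ω u ∧ ∃ p ∈ blowupPolynomials n, ∃ r : ℕ → ℝ,
    (∀ k, 0 < r k) ∧ Tendsto r atTop (𝓝 0) ∧
    ∀ x, Tendsto (fun k => rescaling u x₀ (r k) x) atTop (𝓝 (p x))}

/-! The proof combines the monotonicity formulas of Weiss and Monneau, with integrals over spheres
replaced by integrals against two fixed radial functions on the unit ball: `cutoff` = φ = (1-|x|²)₊²
and `weight` = ω = 4(1-|x|²)₊, linked by ∇φ = -ωx. Everything is measured by the Euler defect e(v) =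
⟨x,∇v⟩ - 2v, which is the velocity of v under v ↦ v(tx)/t² at t = 1 and vanishes on every p in 𝒫.

Weiss: comparing the energy of v with that of a dilate gives an increase of at least (t-1)∫ω e(v)²,
up to O((t-1)²) (`IsLocalSolution.le_energy_rescaling`). Hence the energy of the rescalings is
monotone in the radius. Being bounded below, it also forces e to vanish in the limit r → 0
(`IsLocalSolution.tendsto_eulerDefect`). All elements of 𝒫 have the same energy `polyEnergy`, so at
a singular point the energy at every small radius is at least `polyEnergy`
(`IsLocalSolution.energyBounded`). This bound, unlike membership in Σ, visibly passes to limits of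
points, and all later steps use only it.

Monneau: under the energy bound, ∫ω(v_r - p)² is nondecreasing in r for every p in 𝒫
(`IsLocalSolution.monneau_mono`). If v_r approaches some p along one family of radii, it therefore
converges to p as r → 0.

Existence of such a p: an energy identity together with e → 0 shows that the zero set has vanishing
density (`IsLocalSolution.tendsto_zero_set`). Limits along ultrafilters thus solve Δq = 1 on the
whole space, and Liouville's theorem applied to second differences makes q an element of 𝒫
(`IsC11Zero.mem_blowupPolynomials`).

Continuity: let singular points x_i tend to x₀ in Ω. The energy bound passes to x₀, which thus has a
blow-up q. Monneau's formula at x_i with this q bounds ∫ω(p_{x_i} - q)² by ∫ω(v_{x_i,r} - q)², which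
for fixed r is close to its value at x₀, and that is small for small r (`exists_tendsto_blowup`).
Compactness of K turns this into a uniform δ. -/

namespace ObstacleProblem

open scoped Gradient
open Metric

variable {n : ℕ}

local notation "𝔼" => EuclideanSpace ℝ (Fin n)

/-! ### Gradient calculus and the first-order Taylor estimate -/

section Gradient

variable {F : Type*} [NormedAddCommGroup F] [InnerProductSpace ℝ F] [CompleteSpace F]

theorem hasGradientAt_mul {f g : F → ℝ} {f' g' x : F} (hf : HasGradientAt f f' x)
    (hg : HasGradientAt g g' x) :
    HasGradientAt (fun y => f y * g y) (f x • g' + g x • f') x := by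
  rw [hasGradientAt_iff_hasFDerivAt] at *
  exact (hf.mul hg).congr_fderiv (by simp)

theorem hasGradientAt_add {f g : F → ℝ} {f' g' x : F} (hf : HasGradientAt f f' x)
    (hg : HasGradientAt g g' x) : HasGradientAt (fun y => f y + g y) (f' + g') x := by
  rw [hasGradientAt_iff_hasFDerivAt] at *
  exact (hf.add hg).congr_fderiv (by simp)

theorem hasGradientAt_sub {f g : F → ℝ} {f' g' x : F} (hf : HasGradientAt f f' x)
    (hg : HasGradientAt g g' x) : HasGradientAt (fun y => f y - g y) (f' - g') x := by
  rw [hasGradientAt_iff_hasFDerivAt] at *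
  exact (hf.sub hg).congr_fderiv (by simp)

theorem hasGradientAt_comp_affine {f : F → ℝ} {f' y x : F} (r c : ℝ)
    (hf : HasGradientAt f f' (y + r • x)) :
    HasGradientAt (fun z => c * f (y + r • z)) ((c * r) • f') x := by
  rw [hasGradientAt_iff_hasFDerivAt] at *
  have h : HasFDerivAt (fun z : F => y + r • z) (r • ContinuousLinearMap.id ℝ F) x :=
    ((hasFDerivAt_id x).const_smul r).const_add y
  have := (hf.comp x h).const_mul c
  refine this.congr_fderiv ?_
  ext z
  simp [mul_assoc]

theorem hasDerivAt_comp_lineMap {f : F → ℝ} (hf : Differentiable ℝ f) (x d : F) (t : ℝ) :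
    HasDerivAt (fun s : ℝ => f (x + s • d)) (inner ℝ (∇ f (x + t • d)) d) t := by
  have h1 : HasFDerivAt f (fderiv ℝ f (x + t • d)) (x + t • d) := (hf _).hasFDerivAt
  have h2 : HasDerivAt (fun s : ℝ => x + s • d) d t := by
    simpa using ((hasDerivAt_id t).smul_const d).const_add x
  rw [inner_gradient_left]
  exact h1.comp_hasDerivAt t h2

theorem continuous_gradient {f : F → ℝ} (hf : ContDiff ℝ 1 f) : Continuous (∇ f) :=
  (InnerProductSpace.toDual ℝ F).symm.continuous.comp (hf.continuous_fderiv one_ne_zero)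

theorem contDiff_one_of_gradient {f : F → ℝ} (hf : Differentiable ℝ f)
    (h : Continuous (∇ f)) : ContDiff ℝ 1 f := by
  rw [contDiff_one_iff_fderiv]
  refine ⟨hf, ?_⟩
  rw [← toDual_comp_gradient]
  exact (InnerProductSpace.toDual ℝ F).continuous.comp h

theorem norm_gradient_sub_gradient (f : F → ℝ) (x y : F) :
    ‖∇ f x - ∇ f y‖ = ‖fderiv ℝ f x - fderiv ℝ f y‖ := by
  rw [gradient, gradient, ← map_sub, LinearIsometryEquiv.norm_map]

/-- First-order Taylor estimate for a function with Lipschitz gradient. -/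
theorem abs_sub_sub_inner_gradient_le {f : F → ℝ} {L : ℝ} (hf : Differentiable ℝ f)
    (hL : ∀ x y, ‖∇ f x - ∇ f y‖ ≤ L * ‖x - y‖) (x d : F) :
    |f (x + d) - f x - inner ℝ (∇ f x) d| ≤ L * ‖d‖ ^ 2 := by
  have hder : ∀ t ∈ Icc (0 : ℝ) 1,
      HasDerivWithinAt (fun s : ℝ => f (x + s • d) - s * inner ℝ (∇ f x) d)
        (inner ℝ (∇ f (x + t • d)) d - inner ℝ (∇ f x) d) (Icc 0 1) t := by
    intro t _
    refine ((hasDerivAt_comp_lineMap hf x d t).sub ?_).hasDerivWithinAt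
    simpa using (hasDerivAt_id t).mul_const (inner ℝ (∇ f x) d)
  have hb : ∀ t ∈ Ico (0 : ℝ) 1,
      ‖inner ℝ (∇ f (x + t • d)) d - inner ℝ (∇ f x) d‖ ≤ L * ‖d‖ ^ 2 := by
    intro t ht
    rw [← inner_sub_left]
    calc ‖inner ℝ (∇ f (x + t • d) - ∇ f x) d‖ ≤ ‖∇ f (x + t • d) - ∇ f x‖ * ‖d‖ :=
          norm_inner_le_norm _ _
      _ ≤ (L * ‖(x + t • d) - x‖) * ‖d‖ := by gcongr; exact hL _ _
      _ = t * (L * ‖d‖) * ‖d‖ := by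
          rw [add_sub_cancel_left, norm_smul, Real.norm_of_nonneg ht.1]; ring
      _ ≤ 1 * (L * ‖d‖) * ‖d‖ := by
          have : 0 ≤ L * ‖d‖ := by
            have := (norm_nonneg _).trans (hL d 0)
            simpa using this
          gcongr
          exact ht.2.le
      _ = L * ‖d‖ ^ 2 := by ring
  have := norm_image_sub_le_of_norm_deriv_le_segment' hder hb 1 (by simp)
  simp only [one_smul, one_mul, zero_smul, add_zero, zero_mul, sub_zero, mul_one,
    Real.norm_eq_abs] at this
  convert this using 2
  ring

end Gradient

/-! ### The radial weight and cutoff -/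

section Weights

/-- The weight `4 (1 - |x|²)₊`. -/
noncomputable def weight (x : 𝔼) : ℝ := 4 * max 0 (1 - ‖x‖ ^ 2)

/-- The cutoff `(1 - |x|²)₊²`; its gradient is `-weight x • x`. -/
noncomputable def cutoff (x : 𝔼) : ℝ := max 0 (1 - ‖x‖ ^ 2) ^ 2

theorem continuous_weight : Continuous (weight : 𝔼 → ℝ) := by unfold weight; fun_prop

theorem continuous_cutoff : Continuous (cutoff : 𝔼 → ℝ) := by unfold cutoff; fun_prop

theorem weight_nonneg (x : 𝔼) : 0 ≤ weight x := by unfold weight; positivity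

theorem cutoff_nonneg (x : 𝔼) : 0 ≤ cutoff x := by unfold cutoff; positivity

theorem max_le_one (x : 𝔼) : max 0 (1 - ‖x‖ ^ 2) ≤ 1 :=
  max_le zero_le_one (by nlinarith [sq_nonneg ‖x‖])

theorem cutoff_le_weight (x : 𝔼) : cutoff x ≤ weight x := by
  have h := max_le_one x
  have h0 : 0 ≤ max 0 (1 - ‖x‖ ^ 2) := le_max_left _ _
  unfold cutoff weight
  nlinarith

theorem weight_mul_norm_sq (x : 𝔼) : weight x * ‖x‖ ^ 2 = weight x - 4 * cutoff x := by
  unfold cutoff weight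
  rcases le_total 0 (1 - ‖x‖ ^ 2) with h | h
  · rw [max_eq_right h]; ring
  · rw [max_eq_left h]; ring

theorem weight_eq_zero {x : 𝔼} (h : 1 ≤ ‖x‖) : weight x = 0 := by
  unfold weight
  rw [max_eq_left (by nlinarith), mul_zero]

theorem cutoff_eq_zero {x : 𝔼} (h : 1 ≤ ‖x‖) : cutoff x = 0 := by
  unfold cutoff
  rw [max_eq_left (by nlinarith), zero_pow two_ne_zero]

theorem cutoff_pos {x : 𝔼} (h : ‖x‖ < 1) : 0 < cutoff x := by
  unfold cutoff
  have : 0 < 1 - ‖x‖ ^ 2 := by nlinarith [norm_nonneg x]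
  rw [max_eq_right this.le]
  positivity

theorem weight_pos {x : 𝔼} (h : ‖x‖ < 1) : 0 < weight x :=
  (cutoff_pos h).trans_le (cutoff_le_weight x)

theorem hasCompactSupport_weight : HasCompactSupport (weight : 𝔼 → ℝ) :=
  HasCompactSupport.intro (isCompact_closedBall 0 1) fun x hx =>
    weight_eq_zero (by simpa using (not_le.1 fun h => hx (by simpa using h)).le)

theorem hasCompactSupport_cutoff : HasCompactSupport (cutoff : 𝔼 → ℝ) :=
  HasCompactSupport.intro (isCompact_closedBall 0 1) fun x hx =>
    cutoff_eq_zero (by simpa using (not_le.1 fun h => hx (by simpa using h)).le)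

theorem tsupport_cutoff_subset : tsupport (cutoff : 𝔼 → ℝ) ⊆ closedBall 0 1 := by
  refine closure_minimal (fun x hx => ?_) isClosed_closedBall
  by_contra h
  exact hx (cutoff_eq_zero (by simpa using (not_le.1 fun h' => h (by simpa using h')).le))

/-- Squaring removes the corner of the truncation, so `cutoff` is C¹ across the unit sphere and is
admissible as a test function. -/
theorem hasDerivAt_max_zero_sq (t : ℝ) :
    HasDerivAt (fun s : ℝ => max 0 s ^ 2) (2 * max 0 t) t := by
  rcases lt_trichotomy t 0 with h | rfl | h
  · have : (fun s : ℝ => max 0 s ^ 2) =ᶠ[𝓝 t] fun _ => 0 := by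
      filter_upwards [Iio_mem_nhds h] with s hs
      rw [max_eq_left (mem_Iio.1 hs).le]; norm_num
    rw [max_eq_left h.le, mul_zero]
    exact (hasDerivAt_const t (0 : ℝ)).congr_of_eventuallyEq this
  · rw [max_self, mul_zero, hasDerivAt_iff_isLittleO_nhds_zero]
    refine Asymptotics.IsBigO.trans_isLittleO (g := fun h : ℝ => h ^ 2) ?_ ?_
    · refine Asymptotics.IsBigO.of_bound 1 (Eventually.of_forall fun s => ?_)
      simp only [zero_add, max_self, smul_zero, sub_zero, norm_pow, one_mul, Real.norm_eq_abs]
      norm_num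
      rcases le_total 0 s with h | h <;> simp [h]
      positivity
    · simpa using Asymptotics.isLittleO_pow_id (𝕜 := ℝ) (n := 2) (by norm_num)
  · have : (fun s : ℝ => max 0 s ^ 2) =ᶠ[𝓝 t] fun s => s ^ 2 := by
      filter_upwards [Ioi_mem_nhds h] with s hs
      rw [max_eq_right (mem_Ioi.1 hs).le]
    rw [max_eq_right h.le]
    simpa using (hasDerivAt_pow 2 t).congr_of_eventuallyEq this

theorem hasGradientAt_cutoff (x : 𝔼) : HasGradientAt cutoff (-(weight x) • x) x := by
  rw [hasGradientAt_iff_hasFDerivAt]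
  have h1 : HasFDerivAt (fun y : 𝔼 => 1 - ‖y‖ ^ 2) (-(2 • innerSL ℝ x)) x :=
    (hasStrictFDerivAt_norm_sq x).hasFDerivAt.const_sub 1
  have h2 := (hasDerivAt_max_zero_sq (1 - ‖x‖ ^ 2)).comp_hasFDerivAt x h1
  refine h2.congr_fderiv ?_
  ext y
  simp [weight]
  ring

theorem contDiff_cutoff : ContDiff ℝ 1 (cutoff : 𝔼 → ℝ) := by
  refine contDiff_one_of_gradient (fun x => (hasGradientAt_cutoff x).differentiableAt) ?_
  rw [gradient_eq hasGradientAt_cutoff]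
  exact continuous_weight.neg.smul continuous_id

theorem integrable_weight_mul {g : 𝔼 → ℝ} (hg : Continuous g) :
    Integrable (fun x => weight x * g x) :=
  (continuous_weight.mul hg).integrable_of_hasCompactSupport hasCompactSupport_weight.mul_right

theorem integrable_cutoff_mul {g : 𝔼 → ℝ} (hg : Continuous g) :
    Integrable (fun x => cutoff x * g x) :=
  (continuous_cutoff.mul hg).integrable_of_hasCompactSupport hasCompactSupport_cutoff.mul_right

theorem integrable_weight : Integrable (weight : 𝔼 → ℝ) :=
  continuous_weight.integrable_of_hasCompactSupport hasCompactSupport_weight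

theorem integrable_cutoff : Integrable (cutoff : 𝔼 → ℝ) :=
  continuous_cutoff.integrable_of_hasCompactSupport hasCompactSupport_cutoff

theorem integral_cutoff_pos : 0 < ∫ x : 𝔼, cutoff x :=
  continuous_cutoff.integral_pos_of_hasCompactSupport_nonneg_nonzero hasCompactSupport_cutoff
    cutoff_nonneg (cutoff_pos (x := 0) (by simp)).ne'

theorem integral_weight_pos : 0 < ∫ x : 𝔼, weight x :=
  continuous_weight.integral_pos_of_hasCompactSupport_nonneg_nonzero hasCompactSupport_weight
    weight_nonneg (weight_pos (x := 0) (by simp)).ne'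

theorem integral_weight_mul_mono {f g : 𝔼 → ℝ} (hf : Continuous f) (hg : Continuous g)
    (h : ∀ x, ‖x‖ ≤ 1 → f x ≤ g x) : ∫ x, weight x * f x ≤ ∫ x, weight x * g x := by
  refine integral_mono (integrable_weight_mul hf) (integrable_weight_mul hg) fun x => ?_
  rcases le_total ‖x‖ 1 with hx | hx
  · exact mul_le_mul_of_nonneg_left (h x hx) (weight_nonneg x)
  · simp [weight_eq_zero hx]

end Weights

/-! ### The weak Laplace equation -/

section WeakLaplacian

/-- `Δ v = f` in `U` in the weak sense, tested against compactly supported `C¹` functions. -/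
def WeakLaplacianOn (U : Set 𝔼) (v f : 𝔼 → ℝ) : Prop :=
  ∀ ζ : 𝔼 → ℝ, ContDiff ℝ 1 ζ → HasCompactSupport ζ → tsupport ζ ⊆ U →
    ∫ x, inner ℝ (∇ v x) (∇ ζ x) = -∫ x, f x * ζ x

/-- Integration by parts for a merely Lipschitz factor; it is applied with g a partial derivative of
a C^{1,1} function. -/
theorem integral_fderiv_mul_fderiv {g ζ : 𝔼 → ℝ} {C : NNReal} (hg : LipschitzWith C g)
    (hζ : ContDiff ℝ 1 ζ) (hc : HasCompactSupport ζ) (e : 𝔼) :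
    ∫ x, g x * fderiv ℝ ζ x e = -∫ x, lineDeriv ℝ g x e * ζ x := by
  obtain ⟨D, hD⟩ := ContDiff.lipschitzWith_of_hasCompactSupport hc hζ one_ne_zero
  rw [hg.integral_lineDeriv_mul_eq hD hc, ← integral_neg]
  congr 1 with x
  rw [((hζ.differentiable one_ne_zero) x).lineDeriv_eq_fderiv, map_neg]
  ring

theorem integrable_lineDeriv_mul {g ζ : 𝔼 → ℝ} {C : NNReal} (hg : LipschitzWith C g)
    (hζ : Continuous ζ) (hc : HasCompactSupport ζ) (e : 𝔼) :
    Integrable (fun x => lineDeriv ℝ g x e * ζ x) := by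
  refine ((hζ.integrable_of_hasCompactSupport hc (μ := volume)).smul_of_top_left
    (hg.memLp_lineDeriv e)).congr (Eventually.of_forall fun x => ?_)
  simp [mul_comm]

/-- An almost everywhere equation for a `C^{1,1}` function holds weakly. -/
theorem weakLaplacianOn_of_ae {U : Set 𝔼} {v f : 𝔼 → ℝ} {K : NNReal}
    (hL : LipschitzWith K (fderiv ℝ v))
    (h : ∀ᵐ x ∂(volume : Measure 𝔼), x ∈ U → (Δ v) x = f x) : WeakLaplacianOn U v f := by
  intro ζ hζ hc hU
  set b := EuclideanSpace.basisFun (Fin n) ℝ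
  have hg : ∀ i, LipschitzWith (K * ‖b i‖₊) (fun x => fderiv ℝ v x (b i)) := fun i => by
    refine LipschitzWith.of_dist_le_mul fun x y => ?_
    rw [dist_eq_norm, ← sub_apply]
    calc ‖(fderiv ℝ v x - fderiv ℝ v y) (b i)‖ ≤ ‖fderiv ℝ v x - fderiv ℝ v y‖ * ‖b i‖ :=
          ContinuousLinearMap.le_opNorm _ _
      _ ≤ (K * ‖x - y‖) * ‖b i‖ := by gcongr; exact hL.norm_sub_le x y
      _ = _ := by rw [dist_eq_norm]; push_cast; ring
  have h1 : ∀ x, inner ℝ (∇ v x) (∇ ζ x) = ∑ i, fderiv ℝ v x (b i) * fderiv ℝ ζ x (b i) := by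
    intro x
    rw [← b.sum_inner_mul_inner]
    refine Finset.sum_congr rfl fun i _ => ?_
    rw [inner_gradient_left, real_inner_comm, inner_gradient_left]
  have hint : ∀ i, Integrable (fun x => fderiv ℝ v x (b i) * fderiv ℝ ζ x (b i)) := fun i => by
    refine ((hg i).continuous.mul ((hζ.continuous_fderiv one_ne_zero).clm_apply
      continuous_const)).integrable_of_hasCompactSupport ?_
    exact ((hc.fderiv ℝ).comp_left (g := fun L : 𝔼 →L[ℝ] ℝ => L (b i)) rfl).mul_left
  simp_rw [h1]
  rw [integral_finsetSum _ fun i _ => hint i]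
  simp_rw [fun i => integral_fderiv_mul_fderiv (hg i) hζ hc (b i)]
  rw [Finset.sum_neg_distrib, ← integral_finsetSum _
    fun i _ => integrable_lineDeriv_mul (hg i) hζ.continuous hc (b i)]
  congr 1
  refine integral_congr_ae ?_
  -- By Rademacher, `fderiv ℝ v` is differentiable almost everywhere, and there the line derivatives
  -- of the partials add up to the Laplacian.
  filter_upwards [h, hL.ae_differentiableAt] with x hx hd
  by_cases hxU : x ∈ U
  · rw [← hx hxU, InnerProductSpace.laplacian_eq_iteratedFDeriv_orthonormalBasis v b,
      ← Finset.sum_mul]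
    congr 1
    refine Finset.sum_congr rfl fun i _ => ?_
    rw [iteratedFDeriv_two_apply]
    have : HasFDerivAt (fun y => fderiv ℝ v y (b i))
        ((fderiv ℝ (fderiv ℝ v) x).flip (b i)) x := by
      exact ((ContinuousLinearMap.apply ℝ ℝ (b i)).hasFDerivAt.comp x hd.hasFDerivAt)
    rw [(this.hasLineDerivAt (b i)).lineDeriv]
    simp
  · have : ζ x = 0 := image_eq_zero_of_notMem_tsupport fun hx' => hxU (hU hx')
    simp [this]

theorem WeakLaplacianOn.sub {U : Set 𝔼} {v w f g : 𝔼 → ℝ} (hv : ContDiff ℝ 1 v)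
    (hw : ContDiff ℝ 1 w) (hvf : WeakLaplacianOn U v f) (hwg : WeakLaplacianOn U w g)
    (hf : ∀ ζ : 𝔼 → ℝ, Continuous ζ → HasCompactSupport ζ → Integrable (fun x => f x * ζ x))
    (hg : ∀ ζ : 𝔼 → ℝ, Continuous ζ → HasCompactSupport ζ → Integrable (fun x => g x * ζ x)) :
    WeakLaplacianOn U (fun x => v x - w x) (fun x => f x - g x) := by
  intro ζ hζ hc hU
  have h1 : ∀ x, ∇ (fun x => v x - w x) x = ∇ v x - ∇ w x := fun x =>
    (hasGradientAt_sub (hv.differentiable one_ne_zero x).hasGradientAt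
      (hw.differentiable one_ne_zero x).hasGradientAt).gradient
  have hcg : HasCompactSupport (∇ ζ) :=
    (hc.fderiv ℝ).comp_left (g := (InnerProductSpace.toDual ℝ 𝔼).symm) (map_zero _)
  have hint : ∀ w : 𝔼 → ℝ, ContDiff ℝ 1 w →
      Integrable (fun x => inner ℝ (∇ w x) (∇ ζ x)) := fun w hw =>
    ((continuous_gradient hw).inner (continuous_gradient hζ)).integrable_of_hasCompactSupport
      (hcg.mono fun x hx hx' => hx (by simp only [hx', inner_zero_right]))
  simp_rw [h1, inner_sub_left, sub_mul]
  rw [integral_sub (hint v hv) (hint w hw), integral_sub (hf ζ hζ.continuous hc)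
    (hg ζ hζ.continuous hc), hvf ζ hζ hc hU, hwg ζ hζ hc hU]
  ring

theorem WeakLaplacianOn.mono {U V : Set 𝔼} {v f : 𝔼 → ℝ} (h : WeakLaplacianOn V v f)
    (hUV : U ⊆ V) : WeakLaplacianOn U v f :=
  fun ζ hζ hc hU => h ζ hζ hc (hU.trans hUV)

theorem WeakLaplacianOn.comp_affine {U V : Set 𝔼} {v f : 𝔼 → ℝ} (hv : Differentiable ℝ v)
    (h : WeakLaplacianOn U v f) (y : 𝔼) {r : ℝ} (hr : r ≠ 0) (c : ℝ)
    (hUV : ∀ x ∈ V, y + r • x ∈ U) :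
    WeakLaplacianOn V (fun x => c * v (y + r • x)) (fun x => c * r ^ 2 * f (y + r • x)) := by
  intro ζ hζ hc hV
  -- The test function transported back by the inverse affine map. The factor 1 matches the form of
  -- `hasGradientAt_comp_affine`.
  set ξ : 𝔼 → ℝ := fun z => 1 * ζ (-(r⁻¹ • y) + r⁻¹ • z)
  have hr' : ∀ x, -(r⁻¹ • y) + r⁻¹ • (y + r • x) = x := fun x => by
    rw [smul_add, smul_smul, inv_mul_cancel₀ hr, one_smul, neg_add_cancel_left]
  have hr'' : ∀ z, y + r • (-(r⁻¹ • y) + r⁻¹ • z) = z := fun z => by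
    rw [smul_add, smul_neg, smul_smul, smul_smul, mul_inv_cancel₀ hr, one_smul, one_smul,
      add_neg_cancel_left]
  have hξ : ContDiff ℝ 1 ξ := by fun_prop
  let e : 𝔼 ≃ₜ 𝔼 := (Homeomorph.smulOfNeZero r⁻¹ (inv_ne_zero hr)).trans
    (Homeomorph.addLeft (-(r⁻¹ • y)))
  have hξe : ξ = ζ ∘ e := by ext z; simp [ξ, e]
  have hcξ : HasCompactSupport ξ := by rw [hξe]; exact hc.comp_homeomorph e
  have hsupp : tsupport ξ ⊆ U := by
    rw [hξe, tsupport_comp_eq_preimage]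
    intro z hz
    have := hUV _ (hV hz)
    rwa [show y + r • e z = z from hr'' z] at this
  have key := h ξ hξ hcξ hsupp
  have hgζ : ∀ x, ∇ ξ (y + r • x) = r⁻¹ • ∇ ζ x := fun x => by
    have := (hasGradientAt_comp_affine (f := ζ) (y := -(r⁻¹ • y)) (x := y + r • x) r⁻¹ 1
      ((hζ.differentiable one_ne_zero) _).hasGradientAt).gradient
    rw [hr', one_mul] at this
    exact this
  have hgv : ∀ x, ∇ (fun x => c * v (y + r • x)) x = (c * r) • ∇ v (y + r • x) := fun x =>
    (hasGradientAt_comp_affine r c (hv _).hasGradientAt).gradient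
  have chg : ∀ F : 𝔼 → ℝ, ∫ x, F (y + r • x) = |(r ^ n)⁻¹| * ∫ x, F x := fun F => by
    have := Measure.integral_comp_smul volume (fun x => F (y + x)) r
    simpa [integral_add_left_eq_self] using this
  have e1 : ∀ x, inner ℝ (∇ (fun x => c * v (y + r • x)) x) (∇ ζ x)
      = c * r ^ 2 * inner ℝ (∇ v (y + r • x)) (∇ ξ (y + r • x)) := fun x => by
    rw [hgv, hgζ, real_inner_smul_left, real_inner_smul_right]
    field_simp
  have e2 : ∀ x, c * r ^ 2 * f (y + r • x) * ζ x
      = c * r ^ 2 * (f (y + r • x) * ξ (y + r • x)) := fun x => by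
    simp only [ξ, hr']; ring
  simp_rw [e1, e2]
  rw [integral_const_mul, integral_const_mul,
    chg fun x => inner ℝ (∇ v x) (∇ ξ x), chg fun x => f x * ξ x, key]
  ring

end WeakLaplacian

/-! ### Quadratic polynomials -/

section QuadraticPoly

theorem quadraticPoly_eq_inner (A : Matrix (Fin n) (Fin n) ℝ) (x : 𝔼) :
    quadraticPoly A x = 1 / 2 * inner ℝ (Matrix.toEuclideanCLM (n := Fin n) (𝕜 := ℝ) A x) x := by
  rw [quadraticPoly, EuclideanSpace.inner_eq_star_dotProduct]
  simp [dotProduct_comm]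

theorem hasGradientAt_quadraticPoly {A : Matrix (Fin n) (Fin n) ℝ} (hA : A.IsHermitian) (x : 𝔼) :
    HasGradientAt (quadraticPoly A) (Matrix.toEuclideanCLM (n := Fin n) (𝕜 := ℝ) A x) x := by
  set T := Matrix.toEuclideanCLM (n := Fin n) (𝕜 := ℝ) A with hT
  have hsymm : ∀ x y, inner ℝ (T x) y = inner ℝ x (T y) := by
    have := Matrix.isSymmetric_toEuclideanLin_iff.2 hA
    intro x y
    exact this x y
  rw [hasGradientAt_iff_hasFDerivAt]
  have h := ((T.hasFDerivAt (x := x)).inner ℝ (hasFDerivAt_id x)).const_mul (1 / 2)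
  have hq : quadraticPoly A = fun y => 1 / 2 * inner ℝ (T y) (id y) :=
    funext (quadraticPoly_eq_inner A)
  rw [hq]
  refine h.congr_fderiv ?_
  ext y
  simp [fderivInnerCLM_apply, hsymm y x, real_inner_comm]
  ring

theorem gradient_quadraticPoly {A : Matrix (Fin n) (Fin n) ℝ} (hA : A.IsHermitian) (x : 𝔼) :
    ∇ (quadraticPoly A) x = Matrix.toEuclideanCLM (n := Fin n) (𝕜 := ℝ) A x :=
  (hasGradientAt_quadraticPoly hA x).gradient

theorem differentiable_quadraticPoly {A : Matrix (Fin n) (Fin n) ℝ} (hA : A.IsHermitian) :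
    Differentiable ℝ (quadraticPoly A) :=
  fun x => (hasGradientAt_quadraticPoly hA x).differentiableAt

theorem contDiff_quadraticPoly {A : Matrix (Fin n) (Fin n) ℝ} (hA : A.IsHermitian) :
    ContDiff ℝ 1 (quadraticPoly A) := by
  refine contDiff_one_of_gradient (differentiable_quadraticPoly hA) ?_
  rw [funext (gradient_quadraticPoly hA)]
  exact ContinuousLinearMap.continuous _

theorem inner_gradient_quadraticPoly {A : Matrix (Fin n) (Fin n) ℝ} (hA : A.IsHermitian) (x : 𝔼) :
    inner ℝ x (∇ (quadraticPoly A) x) = 2 * quadraticPoly A x := by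
  rw [gradient_quadraticPoly hA, quadraticPoly_eq_inner, real_inner_comm]
  ring

theorem quadraticPoly_smul (A : Matrix (Fin n) (Fin n) ℝ) (t : ℝ) (x : 𝔼) :
    quadraticPoly A (t • x) = t ^ 2 * quadraticPoly A x := by
  simp only [quadraticPoly_eq_inner, map_smul, real_inner_smul_left, real_inner_smul_right]
  ring

theorem weakLaplacianOn_quadraticPoly {A : Matrix (Fin n) (Fin n) ℝ} (hA : A.IsHermitian)
    (U : Set 𝔼) : WeakLaplacianOn U (quadraticPoly A) (fun _ => A.trace) := by
  set T := Matrix.toEuclideanCLM (n := Fin n) (𝕜 := ℝ) A with hT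
  set M : 𝔼 →L[ℝ] (𝔼 →L[ℝ] ℝ) := (innerSL ℝ).comp T
  have hM : fderiv ℝ (quadraticPoly A) = M := by
    rw [← toDual_comp_gradient]
    ext x y
    simp [gradient_quadraticPoly hA, M, ← hT]
  refine weakLaplacianOn_of_ae (K := ‖M‖₊) ?_ (Eventually.of_forall fun x _ => ?_)
  · rw [hM]; exact M.lipschitz
  · rw [InnerProductSpace.laplacian_eq_iteratedFDeriv_orthonormalBasis _
      (EuclideanSpace.basisFun (Fin n) ℝ)]
    simp only [iteratedFDeriv_two_apply, hM, ContinuousLinearMap.fderiv]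
    simp [M, Matrix.trace, hT, EuclideanSpace.inner_single_right]

end QuadraticPoly

/-! ### The truncated Weiss energy and its integral identities -/

section Energy

/-- The defect `⟨x, ∇ v⟩ - 2 v` in Euler's identity for functions homogeneous of degree two. -/
noncomputable def eulerDefect (v : 𝔼 → ℝ) (x : 𝔼) : ℝ := inner ℝ x (∇ v x) - 2 * v x

/-- A smoothly truncated version of Weiss' boundary adjusted energy. -/
noncomputable def energy (v : 𝔼 → ℝ) : ℝ :=
  ∫ x, (cutoff x * (‖∇ v x‖ ^ 2 / 2 + v x) - weight x * v x ^ 2)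

theorem continuous_eulerDefect {v : 𝔼 → ℝ} (hv : ContDiff ℝ 1 v) : Continuous (eulerDefect v) := by
  have h1 := continuous_gradient hv
  have h2 := hv.continuous
  unfold eulerDefect
  fun_prop

theorem integrable_energy {v : 𝔼 → ℝ} (hv : ContDiff ℝ 1 v) :
    Integrable fun x => cutoff x * (‖∇ v x‖ ^ 2 / 2 + v x) - weight x * v x ^ 2 := by
  have h1 := continuous_gradient hv
  have h2 := hv.continuous
  exact (integrable_cutoff_mul (by fun_prop)).sub (integrable_weight_mul (by fun_prop))

theorem gradient_sub' {v w : 𝔼 → ℝ} (hv : ContDiff ℝ 1 v) (hw : ContDiff ℝ 1 w) (x : 𝔼) :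
    ∇ (fun x => v x - w x) x = ∇ v x - ∇ w x :=
  (hasGradientAt_sub (hv.differentiable one_ne_zero x).hasGradientAt
    (hw.differentiable one_ne_zero x).hasGradientAt).gradient

/-- Testing the weak equation for `v` against `cutoff * d`. -/
theorem integral_cutoff_mul_inner_gradient {U : Set 𝔼} {v d f : 𝔼 → ℝ} (hU : closedBall 0 1 ⊆ U)
    (hv : ContDiff ℝ 1 v) (hd : ContDiff ℝ 1 d) (hf : WeakLaplacianOn U v f) :
    ∫ x, cutoff x * inner ℝ (∇ v x) (∇ d x)
      = (∫ x, weight x * (d x * inner ℝ x (∇ v x))) - ∫ x, f x * (cutoff x * d x) := by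
  have h := hf (fun x => cutoff x * d x) (contDiff_cutoff.mul hd)
    hasCompactSupport_cutoff.mul_right
    ((tsupport_mul_subset_left (f := cutoff) (g := d)).trans (tsupport_cutoff_subset.trans hU))
  have hg : ∀ x, inner ℝ (∇ v x) (∇ (fun x => cutoff x * d x) x)
      = cutoff x * inner ℝ (∇ v x) (∇ d x) - weight x * (d x * inner ℝ x (∇ v x)) := fun x => by
    rw [(hasGradientAt_mul (hasGradientAt_cutoff x)
      (hd.differentiable one_ne_zero x).hasGradientAt).gradient]
    simp only [inner_add_right, real_inner_smul_right, real_inner_comm x]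
    ring
  have hgv := continuous_gradient hv
  have hgd := continuous_gradient hd
  have hdc := hd.continuous
  simp_rw [hg] at h
  rw [integral_sub (integrable_cutoff_mul (by fun_prop)) (integrable_weight_mul (by fun_prop))] at h
  linarith

/-- Exact second-order expansion of a quadratic functional at v. The cross term ∫φ⟨∇v,∇(w-v)⟩ is
integrated by parts; what falls on φ combines with -2ωv(w-v) into the Euler defect. It yields Weiss'
formula with w a dilate of v, and Monneau's with a polynomial as the base point. -/
theorem energy_sub_energy {U : Set 𝔼} {v w f : 𝔼 → ℝ} (hU : closedBall 0 1 ⊆ U)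
    (hv : ContDiff ℝ 1 v) (hw : ContDiff ℝ 1 w) (hf : WeakLaplacianOn U v f) :
    energy w - energy v
      = (∫ x, cutoff x * (w x - v x)) - (∫ x, f x * (cutoff x * (w x - v x)))
        + (∫ x, weight x * ((w x - v x) * eulerDefect v x))
        + (1 / 2) * (∫ x, cutoff x * ‖∇ w x - ∇ v x‖ ^ 2)
        - ∫ x, weight x * (w x - v x) ^ 2 := by
  have hgv := continuous_gradient hv
  have hgw := continuous_gradient hw
  have hvc := hv.continuous
  have hwc := hw.continuous
  have hev := continuous_eulerDefect hv
  have key := integral_cutoff_mul_inner_gradient hU hv (hw.sub hv) hf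
  simp_rw [gradient_sub' hw hv] at key
  have e1 : energy w - energy v = ∫ x, (cutoff x * inner ℝ (∇ v x) (∇ w x - ∇ v x)
      + cutoff x * (w x - v x) + cutoff x * (1 / 2 * ‖∇ w x - ∇ v x‖ ^ 2)
      - weight x * (2 * v x * (w x - v x)) - weight x * (w x - v x) ^ 2) := by
    unfold energy
    rw [← integral_sub (integrable_energy hw) (integrable_energy hv)]
    congr 1 with x
    rw [@norm_sub_sq_real, inner_sub_right, real_inner_self_eq_norm_sq, real_inner_comm]
    ring
  have e2 : ∫ x, weight x * ((w x - v x) * eulerDefect v x)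
      = (∫ x, weight x * ((w x - v x) * inner ℝ x (∇ v x)))
        - ∫ x, weight x * (2 * v x * (w x - v x)) := by
    rw [← integral_sub (integrable_weight_mul (by fun_prop)) (integrable_weight_mul (by fun_prop))]
    congr 1 with x
    unfold eulerDefect
    ring
  have e3 : ∫ x, cutoff x * (1 / 2 * ‖∇ w x - ∇ v x‖ ^ 2)
      = 1 / 2 * ∫ x, cutoff x * ‖∇ w x - ∇ v x‖ ^ 2 := by
    rw [← integral_const_mul]
    congr 1 with x
    ring
  have i1 : Integrable fun x => cutoff x * inner ℝ (∇ v x) (∇ w x - ∇ v x) :=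
    integrable_cutoff_mul (by fun_prop)
  have i2 : Integrable fun x => cutoff x * (w x - v x) := integrable_cutoff_mul (by fun_prop)
  have i3 : Integrable fun x => cutoff x * (1 / 2 * ‖∇ w x - ∇ v x‖ ^ 2) :=
    integrable_cutoff_mul (by fun_prop)
  have i4 : Integrable fun x => weight x * (2 * v x * (w x - v x)) :=
    integrable_weight_mul (by fun_prop)
  have i5 : Integrable fun x => weight x * (w x - v x) ^ 2 := integrable_weight_mul (by fun_prop)
  rw [e1, integral_sub (((i1.fun_add i2).fun_add i3).sub' i4) i5,
    integral_sub ((i1.fun_add i2).fun_add i3) i4, integral_add (i1.fun_add i2) i3, integral_add i1 i2, key, e2, e3]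
  ring

/-- Testing the equation with φv removes the Dirichlet term; f v = v holds when f is the indicator
of the positivity set of a nonnegative v. -/
theorem energy_eq {U : Set 𝔼} {v f : 𝔼 → ℝ} (hU : closedBall 0 1 ⊆ U)
    (hv : ContDiff ℝ 1 v) (hf : WeakLaplacianOn U v f) (hfv : ∀ x, f x * v x = v x) :
    energy v = 1 / 2 * (∫ x, weight x * (v x * eulerDefect v x))
      + 1 / 2 * ∫ x, cutoff x * v x := by
  have hgv := continuous_gradient hv
  have hvc := hv.continuous
  have hev := continuous_eulerDefect hv
  have key := integral_cutoff_mul_inner_gradient hU hv hv hf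
  have e1 : ∀ x, f x * (cutoff x * v x) = cutoff x * v x := fun x => by
    rw [mul_left_comm, hfv]
  simp_rw [e1, real_inner_self_eq_norm_sq] at key
  have e2 : energy v = 1 / 2 * (∫ x, cutoff x * ‖∇ v x‖ ^ 2) + (∫ x, cutoff x * v x)
      - ∫ x, weight x * v x ^ 2 := by
    have i1 : Integrable fun x => 1 / 2 * (cutoff x * ‖∇ v x‖ ^ 2) :=
      (integrable_cutoff_mul (by fun_prop)).const_mul _
    have i2 : Integrable fun x => cutoff x * v x := integrable_cutoff_mul hvc
    have i3 : Integrable fun x => weight x * v x ^ 2 := integrable_weight_mul (by fun_prop)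
    rw [← integral_const_mul, ← integral_add i1 i2, ← integral_sub (i1.fun_add i2) i3]
    unfold energy
    congr 1 with x
    ring
  have e3 : ∫ x, weight x * (v x * eulerDefect v x)
      = (∫ x, weight x * (v x * inner ℝ x (∇ v x))) - 2 * ∫ x, weight x * v x ^ 2 := by
    rw [← integral_const_mul, ← integral_sub (integrable_weight_mul (by fun_prop))
      ((integrable_weight_mul (by fun_prop)).const_mul _)]
    congr 1 with x
    unfold eulerDefect
    ring
  rw [e2, e3, key]
  ring

theorem integral_weight_mul_eulerDefect {U : Set 𝔼} {v f : 𝔼 → ℝ} (hU : closedBall 0 1 ⊆ U)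
    (hv : ContDiff ℝ 1 v) (hf : WeakLaplacianOn U v f) :
    ∫ x, weight x * eulerDefect v x = (∫ x, f x * cutoff x) - 2 * ∫ x, weight x * v x := by
  have hgv := continuous_gradient hv
  have hvc := hv.continuous
  have key := integral_cutoff_mul_inner_gradient hU hv (contDiff_const (c := (1 : ℝ))) hf
  simp only [gradient_fun_const, inner_zero_right, mul_zero, integral_zero, one_mul, mul_one]
    at key
  have e : ∫ x, weight x * eulerDefect v x
      = (∫ x, weight x * inner ℝ x (∇ v x)) - 2 * ∫ x, weight x * v x := by
    rw [← integral_const_mul, ← integral_sub (integrable_weight_mul (by fun_prop))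
      ((integrable_weight_mul (by fun_prop)).const_mul _)]
    congr 1 with x
    unfold eulerDefect
    ring
  rw [e]
  linarith

/-- No equation for v is needed: the weak equation Δ(|x|²/2) = n is tested with φv. The constant is
n + 4 + 2, with 4 from ω|x|² = ω - 4φ and 2 from the term -2v of the defect. -/
theorem integral_cutoff_mul_eulerDefect {v : 𝔼 → ℝ} (hv : ContDiff ℝ 1 v) :
    ∫ x, cutoff x * eulerDefect v x
      = (∫ x, weight x * v x) - (n + 6) * ∫ x, cutoff x * v x := by
  have hgv := continuous_gradient hv
  have hvc := hv.continuous
  have h1 : (1 : Matrix (Fin n) (Fin n) ℝ).IsHermitian := Matrix.isHermitian_one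
  have key := integral_cutoff_mul_inner_gradient (subset_univ _) (contDiff_quadraticPoly h1) hv
    (weakLaplacianOn_quadraticPoly h1 univ)
  simp only [gradient_quadraticPoly h1, map_one, one_apply_eq_self,
    Matrix.trace_one, Fintype.card_fin] at key
  rw [integral_const_mul] at key
  have e1 : ∫ x, weight x * (v x * inner ℝ x x)
      = (∫ x, weight x * v x) - 4 * ∫ x, cutoff x * v x := by
    rw [← integral_const_mul, ← integral_sub (integrable_weight_mul hvc)
      ((integrable_cutoff_mul hvc).const_mul _)]
    congr 1 with x
    rw [real_inner_self_eq_norm_sq]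
    linear_combination v x * weight_mul_norm_sq x
  have e2 : ∫ x, cutoff x * eulerDefect v x
      = (∫ x, cutoff x * inner ℝ x (∇ v x)) - 2 * ∫ x, cutoff x * v x := by
    rw [← integral_const_mul, ← integral_sub (integrable_cutoff_mul (by fun_prop))
      ((integrable_cutoff_mul hvc).const_mul _)]
    congr 1 with x
    unfold eulerDefect
    ring
  rw [e2, key, e1]
  ring

/-- Eliminating ∫ωv and ∫φv from the three preceding identities expresses the φ-mass of f by the
energy, up to terms linear in the Euler defect. It gives the energy of the polynomials and, later,
the smallness of the zero set. -/
theorem integral_mul_cutoff_eq {U : Set 𝔼} {v f : 𝔼 → ℝ} (hU : closedBall 0 1 ⊆ U)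
    (hv : ContDiff ℝ 1 v) (hf : WeakLaplacianOn U v f) (hfv : ∀ x, f x * v x = v x) :
    ∫ x, f x * cutoff x = 4 * (n + 6) * energy v
      - 2 * (n + 6) * (∫ x, weight x * (v x * eulerDefect v x))
      + 2 * (∫ x, cutoff x * eulerDefect v x) + ∫ x, weight x * eulerDefect v x := by
  rw [energy_eq hU hv hf hfv, integral_weight_mul_eulerDefect hU hv hf,
    integral_cutoff_mul_eulerDefect hv]
  ring

variable (n) in
/-- The energy of the elements of `blowupPolynomials n`. -/
noncomputable def polyEnergy : ℝ := (∫ x : 𝔼, cutoff x) / (4 * (n + 6))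

theorem eulerDefect_quadraticPoly {A : Matrix (Fin n) (Fin n) ℝ} (hA : A.IsHermitian) (x : 𝔼) :
    eulerDefect (quadraticPoly A) x = 0 := by
  rw [eulerDefect, inner_gradient_quadraticPoly hA, sub_self]

theorem energy_quadraticPoly {A : Matrix (Fin n) (Fin n) ℝ} (hA : A.IsHermitian)
    (htr : A.trace = 1) : energy (quadraticPoly A) = polyEnergy n := by
  have hw := weakLaplacianOn_quadraticPoly hA univ
  rw [htr] at hw
  have := integral_mul_cutoff_eq (subset_univ _) (contDiff_quadraticPoly hA) hw (by simp)
  simp only [eulerDefect_quadraticPoly hA, mul_zero, integral_zero, sub_zero, add_zero,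
    one_mul] at this
  rw [polyEnergy, this]
  field_simp

end Energy

/-! ### From infinitesimal inequalities to monotonicity -/

section Monotonicity

/-- A function which decreases at most quadratically under dilations is monotone. -/
theorem le_of_forall_sub_sq_le_mul {F : ℝ → ℝ} {C R : ℝ} (hC : 0 ≤ C)
    (h : ∀ r t, 0 < r → 1 ≤ t → t ≤ 2 → r * t < R → F r - C * (t - 1) ^ 2 ≤ F (r * t))
    {a b : ℝ} (ha : 0 < a) (hab : a ≤ b) (hb : b < R) : F a ≤ F b := by
  -- The interval is cut into N equal steps; N errors of size O(1/N²) add up to O(1/N). The lower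
  -- bound on N keeps every ratio of consecutive radii at most 2.
  have key : ∀ N : ℕ, (b - a) / a ≤ N → 0 < N → F a - C * ((b - a) / a) ^ 2 / N ≤ F b := by
    intro N hN hN0
    have hN0' : (0 : ℝ) < N := by exact_mod_cast hN0
    set δ := (b - a) / N with hδ
    have hδ0 : 0 ≤ δ := div_nonneg (sub_nonneg.2 hab) hN0'.le
    have hδa : δ ≤ a := by
      rw [hδ, div_le_iff₀ hN0']
      rwa [div_le_iff₀ ha, mul_comm] at hN
    have hstep : ∀ k : ℕ, k ≤ N → F a - k * (C * (δ / a) ^ 2) ≤ F (a + k * δ) := by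
      intro k
      induction k with
      | zero => simp
      | succ k ih =>
        intro hk
        have ih := ih (by omega)
        set s := a + k * δ with hs
        have hsa : a ≤ s := by rw [hs]; nlinarith [mul_nonneg (Nat.cast_nonneg (α := ℝ) k) hδ0]
        have hs0 : 0 < s := ha.trans_le hsa
        have h1 : δ / s ≤ δ / a := div_le_div_of_nonneg_left hδ0 ha hsa
        have h2 : δ / a ≤ 1 := (div_le_one ha).2 hδa
        have h0 : 0 ≤ δ / s := div_nonneg hδ0 hs0.le
        have hmul : s * (1 + δ / s) = a + (k + 1 : ℕ) * δ := by
          rw [mul_add, mul_div_cancel₀ _ hs0.ne', hs]; push_cast; ring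
        have hle : a + (k + 1 : ℕ) * δ ≤ b := by
          have : ((k + 1 : ℕ) : ℝ) * δ ≤ N * δ := by gcongr
          rw [hδ, mul_div_cancel₀ _ hN0'.ne'] at this
          rw [hδ]; linarith
        have h3 := h s (1 + δ / s) hs0 (by linarith) (by linarith) (by rw [hmul]; linarith)
        rw [hmul] at h3
        have h4 : C * (1 + δ / s - 1) ^ 2 ≤ C * (δ / a) ^ 2 := by
          rw [add_sub_cancel_left]; gcongr
        push_cast at h3 ⊢
        linarith
    have := hstep N le_rfl
    rw [hδ, mul_div_cancel₀ _ hN0'.ne', add_sub_cancel] at this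
    convert this using 2
    field_simp
  have hlim : Tendsto (fun N : ℕ => F a - C * ((b - a) / a) ^ 2 / N) atTop (𝓝 (F a - 0)) :=
    tendsto_const_nhds.sub (tendsto_const_div_atTop_nhds_zero_nat _)
  rw [sub_zero] at hlim
  refine le_of_tendsto hlim ?_
  filter_upwards [eventually_ge_atTop ⌈(b - a) / a⌉₊, eventually_gt_atTop 0] with N h1 h2
  exact key N ((Nat.le_ceil _).trans (by exact_mod_cast h1)) h2

/-- If a bounded function increases under dilations at a rate of at least `D`, up to a quadratic
error, then `D` vanishes at zero. -/
theorem tendsto_zero_of_forall_mul_le_sub {F D : ℝ → ℝ} {C B R : ℝ} (hC : 0 ≤ C) (hR : 0 < R)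
    (hB : ∀ r, 0 < r → r < R → B ≤ F r) (hD : ∀ r, 0 ≤ D r)
    (h : ∀ r t, 0 < r → 1 ≤ t → t ≤ 2 → r * t < R →
      F r + (t - 1) * D r - C * (t - 1) ^ 2 ≤ F (r * t)) :
    Tendsto D (𝓝[>] 0) (𝓝 0) := by
  have hmono : ∀ a b, 0 < a → a ≤ b → b < R → F a ≤ F b := fun a b =>
    le_of_forall_sub_sq_le_mul hC fun r t h1 h2 h3 h4 => by
      have := h r t h1 h2 h3 h4
      nlinarith [mul_nonneg (sub_nonneg.2 h2) (hD r)]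
  have hbdd : BddBelow (F '' Ioo 0 R) := ⟨B, by rintro _ ⟨r, hr, rfl⟩; exact hB r hr.1 hr.2⟩
  rw [Metric.tendsto_nhds]
  intro ε hε
  -- The dilation ratio 1 + τ stays fixed as r → 0, chosen so that the quadratic error costs only
  -- ε/4 after division by τ.
  set τ := min 1 (ε / (4 * (C + 1))) with hτ
  have hτ0 : 0 < τ := lt_min one_pos (by positivity)
  have hτ1 : τ ≤ 1 := min_le_left _ _
  have hCτ : C * τ ≤ ε / 4 := by
    calc C * τ ≤ (C + 1) * (ε / (4 * (C + 1))) := by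
          gcongr
          · linarith
          · exact min_le_right _ _
      _ = ε / 4 := by field_simp
  -- F(r₀) is within τε/4 of the infimum, so by monotonicity F gains at most that much between r and
  -- r(1 + τ) ≤ r₀.
  obtain ⟨_, ⟨r₀, hr₀, rfl⟩, hlt⟩ := Real.lt_sInf_add_pos
    (⟨F (R / 2), R / 2, ⟨by linarith, by linarith⟩, rfl⟩ : (F '' Ioo 0 R).Nonempty)
    (show 0 < τ * (ε / 4) by positivity)
  filter_upwards [Ioo_mem_nhdsGT (show (0 : ℝ) < r₀ / 2 by linarith [hr₀.1])] with r hr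
  have hr1 : r * (1 + τ) ≤ r₀ := by nlinarith [hr.1, hr.2]
  have h1 := h r (1 + τ) hr.1 (by linarith) (by linarith) (hr1.trans_lt hr₀.2)
  have h2 := hmono _ _ (mul_pos hr.1 (by linarith)) hr1 hr₀.2
  have h3 : sInf (F '' Ioo 0 R) ≤ F r := csInf_le hbdd ⟨r, ⟨hr.1, by linarith [hr.2, hr₀.2, hr₀.1]⟩, rfl⟩
  rw [add_sub_cancel_left] at h1
  have h4 : τ * D r ≤ τ * (ε / 4 + C * τ) := by nlinarith
  have h5 := le_of_mul_le_mul_left h4 hτ0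
  rw [Real.dist_eq, sub_zero, abs_of_nonneg (hD r)]
  linarith

end Monotonicity

/-! ### Normalized C^{1,1} functions and their rescalings -/

section C11

/-- A `C^{1,1}` function with Lipschitz constant `L` of the gradient which vanishes at the origin
together with its gradient. -/
structure IsC11Zero (L : ℝ) (v : 𝔼 → ℝ) : Prop where
  nonneg_const : 0 ≤ L
  differentiable : Differentiable ℝ v
  norm_gradient_sub_le : ∀ x y, ‖∇ v x - ∇ v y‖ ≤ L * ‖x - y‖
  apply_zero : v 0 = 0
  gradient_zero : ∇ v 0 = 0

theorem continuous_of_norm_sub_le {E F : Type*} [NormedAddCommGroup E] [NormedAddCommGroup F]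
    {f : E → F} {L : ℝ} (h : ∀ x y, ‖f x - f y‖ ≤ L * ‖x - y‖) : Continuous f :=
  (LipschitzWith.of_dist_le' (K := L) fun x y => by simpa [dist_eq_norm] using h x y).continuous

variable {L : ℝ} {v : EuclideanSpace ℝ (Fin n) → ℝ}

theorem IsC11Zero.contDiff (h : IsC11Zero L v) : ContDiff ℝ 1 v :=
  contDiff_one_of_gradient h.differentiable (continuous_of_norm_sub_le h.norm_gradient_sub_le)

theorem IsC11Zero.norm_gradient_le (h : IsC11Zero L v) (x : 𝔼) : ‖∇ v x‖ ≤ L * ‖x‖ := by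
  simpa [h.gradient_zero] using h.norm_gradient_sub_le x 0

theorem IsC11Zero.abs_apply_le (h : IsC11Zero L v) (x : 𝔼) : |v x| ≤ L * ‖x‖ ^ 2 := by
  simpa [h.gradient_zero, h.apply_zero] using
    abs_sub_sub_inner_gradient_le h.differentiable h.norm_gradient_sub_le 0 x

theorem IsC11Zero.abs_le_of_norm_le_one (h : IsC11Zero L v) {x : 𝔼} (hx : ‖x‖ ≤ 1) :
    |v x| ≤ L := by
  have := h.abs_apply_le x
  have h1 : ‖x‖ ^ 2 ≤ 1 := pow_le_one₀ (norm_nonneg x) hx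
  nlinarith [h.nonneg_const]

theorem IsC11Zero.abs_inner_gradient_le (h : IsC11Zero L v) {x : 𝔼} (hx : ‖x‖ ≤ 1) :
    |inner ℝ x (∇ v x)| ≤ L := by
  calc |inner ℝ x (∇ v x)| ≤ ‖x‖ * ‖∇ v x‖ := abs_real_inner_le_norm _ _
    _ ≤ 1 * (L * 1) := by
        have := h.norm_gradient_le x
        have h1 : L * ‖x‖ ≤ L * 1 := mul_le_mul_of_nonneg_left hx h.nonneg_const
        gcongr
        linarith
    _ = L := by ring

theorem IsC11Zero.abs_eulerDefect_le (h : IsC11Zero L v) {x : 𝔼} (hx : ‖x‖ ≤ 1) :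
    |eulerDefect v x| ≤ 3 * L := by
  have h1 := abs_le.1 (h.abs_inner_gradient_le hx)
  have h2 := abs_le.1 (h.abs_le_of_norm_le_one hx)
  rw [eulerDefect, abs_le]
  constructor <;> linarith

theorem rescaling_mul (u : 𝔼 → ℝ) (x₀ : 𝔼) (r t : ℝ) :
    rescaling u x₀ (r * t) = rescaling (rescaling u x₀ r) 0 t := by
  ext x
  simp only [rescaling, zero_add, smul_smul]
  rw [mul_pow, div_div]

theorem rescaling_eq (u : 𝔼 → ℝ) (x₀ : 𝔼) (r : ℝ) :
    rescaling u x₀ r = fun x => (r ^ 2)⁻¹ * u (x₀ + r • x) := by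
  ext x
  rw [rescaling, div_eq_inv_mul]

theorem gradient_rescaling {u : 𝔼 → ℝ} (hu : Differentiable ℝ u) (x₀ : 𝔼) {r : ℝ} (hr : r ≠ 0)
    (x : 𝔼) : ∇ (rescaling u x₀ r) x = r⁻¹ • ∇ u (x₀ + r • x) := by
  rw [rescaling_eq, (hasGradientAt_comp_affine r _ (hu _).hasGradientAt).gradient]
  congr 1
  field_simp

theorem isC11Zero_rescaling {u : 𝔼 → ℝ} (hL : 0 ≤ L) (hu : Differentiable ℝ u)
    (hLip : ∀ x y, ‖∇ u x - ∇ u y‖ ≤ L * ‖x - y‖) {x₀ : 𝔼} (h0 : u x₀ = 0) (hg : ∇ u x₀ = 0)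
    {r : ℝ} (hr : 0 < r) : IsC11Zero L (rescaling u x₀ r) where
  nonneg_const := hL
  differentiable := by
    rw [rescaling_eq]
    exact (hu.comp (by fun_prop)).const_mul _
  norm_gradient_sub_le x y := by
    rw [gradient_rescaling hu _ hr.ne', gradient_rescaling hu _ hr.ne', ← smul_sub, norm_smul,
      norm_inv, Real.norm_of_nonneg hr.le, inv_mul_le_iff₀ hr]
    refine (hLip _ _).trans_eq ?_
    rw [add_sub_add_left_eq_sub, ← smul_sub, norm_smul, Real.norm_of_nonneg hr.le]
    ring
  apply_zero := by simp [rescaling, h0]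
  gradient_zero := by rw [gradient_rescaling hu _ hr.ne']; simp [hg]

theorem IsC11Zero.rescaling (h : IsC11Zero L v) {r : ℝ} (hr : 0 < r) :
    IsC11Zero L (rescaling v 0 r) :=
  isC11Zero_rescaling h.nonneg_const h.differentiable h.norm_gradient_sub_le h.apply_zero
    h.gradient_zero hr

/-- To first order, a dilation moves `v` in the direction of its Euler defect. -/
theorem IsC11Zero.abs_rescaling_sub_le (h : IsC11Zero L v) {t : ℝ} (h1 : 1 ≤ t) (h2 : t ≤ 2)
    {x : 𝔼} (hx : ‖x‖ ≤ 1) :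
    |_root_.rescaling v 0 t x - v x - (t - 1) * eulerDefect v x| ≤ 11 * L * (t - 1) ^ 2 := by
  obtain ⟨τ, rfl⟩ : ∃ τ, t = 1 + τ := ⟨t - 1, by ring⟩
  have hτ0 : 0 ≤ τ := by linarith
  have hτ1 : τ ≤ 1 := by linarith
  have hT := abs_sub_sub_inner_gradient_le h.differentiable h.norm_gradient_sub_le x (τ • x)
  rw [real_inner_smul_right, norm_smul, Real.norm_of_nonneg hτ0, real_inner_comm] at hT
  have hT' : |v (x + τ • x) - v x - τ * inner ℝ x (∇ v x)| ≤ L * τ ^ 2 := by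
    refine hT.trans ?_
    have : (τ * ‖x‖) ^ 2 ≤ (τ * 1) ^ 2 := by gcongr
    rw [mul_one] at this
    exact mul_le_mul_of_nonneg_left this h.nonneg_const
  have hv := h.abs_le_of_norm_le_one hx
  have he := h.abs_eulerDefect_le hx
  set E := v (x + τ • x) - v x - τ * inner ℝ x (∇ v x) with hE
  have hxt : (0 : 𝔼) + (1 + τ) • x = x + τ • x := by rw [zero_add, add_smul, one_smul]
  have hL := h.nonneg_const
  -- Over the common denominator (1 + τ)² all terms of order one in τ cancel, leaving the Taylor
  -- remainder E and terms of order τ².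
  have key : _root_.rescaling v 0 (1 + τ) x - v x - (1 + τ - 1) * eulerDefect v x
      = (E - τ ^ 2 * v x - (2 * τ ^ 2 + τ ^ 3) * eulerDefect v x) / (1 + τ) ^ 2 := by
    rw [_root_.rescaling, hxt, eq_div_iff (by positivity), sub_mul, sub_mul,
      div_mul_cancel₀ _ (by positivity), hE]
    unfold eulerDefect
    ring
  rw [key, abs_div, abs_of_pos (show (0 : ℝ) < (1 + τ) ^ 2 by positivity),
    div_le_iff₀ (by positivity), add_sub_cancel_left]
  have h3 : |E - τ ^ 2 * v x - (2 * τ ^ 2 + τ ^ 3) * eulerDefect v x|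
      ≤ L * τ ^ 2 + τ ^ 2 * L + (2 * τ ^ 2 + τ ^ 3) * (3 * L) := by
    refine (abs_sub _ _).trans ?_
    refine add_le_add ((abs_sub _ _).trans (add_le_add hT' ?_)) ?_
    · rw [abs_mul, abs_of_nonneg (sq_nonneg τ)]; gcongr
    · rw [abs_mul, abs_of_nonneg (show 0 ≤ 2 * τ ^ 2 + τ ^ 3 by positivity)]; gcongr
  refine h3.trans ?_
  have h4 : τ ^ 3 * L ≤ τ ^ 2 * L := by
    have : τ ^ 3 ≤ τ ^ 2 := by nlinarith [sq_nonneg τ]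
    gcongr
  -- The constant is 11 = 1 + 1 + 3·3, from E, from v, and from (2τ² + τ³)·3L with τ ≤ 1.
  have h5 : 11 * L * τ ^ 2 * 1 ≤ 11 * L * τ ^ 2 * (1 + τ) ^ 2 := by
    gcongr
    nlinarith
  nlinarith

theorem IsC11Zero.abs_rescaling_sub_le' (h : IsC11Zero L v) {t : ℝ} (h1 : 1 ≤ t) (h2 : t ≤ 2)
    {x : 𝔼} (hx : ‖x‖ ≤ 1) : |_root_.rescaling v 0 t x - v x| ≤ 14 * L * (t - 1) := by
  have h3 := abs_le.1 (h.abs_rescaling_sub_le h1 h2 hx)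
  have h4 := abs_le.1 (h.abs_eulerDefect_le hx)
  have hL := h.nonneg_const
  have h5 : 11 * L * (t - 1) ^ 2 ≤ 11 * L * (t - 1) := by
    have : (t - 1) ^ 2 ≤ t - 1 := by nlinarith
    gcongr
  have h6 : (t - 1) * eulerDefect v x ≤ (t - 1) * (3 * L) :=
    mul_le_mul_of_nonneg_left h4.2 (by linarith)
  have h7 : (t - 1) * -(3 * L) ≤ (t - 1) * eulerDefect v x :=
    mul_le_mul_of_nonneg_left h4.1 (by linarith)
  rw [abs_le]
  constructor <;> linarith [h3.1, h3.2]

end C11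

/-! ### Weiss' and Monneau's monotonicity formulas -/

section LocalSolution

/-- The characteristic function of `{v > 0}`. -/
noncomputable def positivityIndicator (v : 𝔼 → ℝ) : 𝔼 → ℝ := {y | 0 < v y}.indicator fun _ => 1

variable {L R : ℝ} {v : EuclideanSpace ℝ (Fin n) → ℝ}

theorem positivityIndicator_of_pos {x : 𝔼} (h : 0 < v x) : positivityIndicator v x = 1 :=
  indicator_of_mem (show x ∈ {y | 0 < v y} from h) _

theorem positivityIndicator_of_nonpos {x : 𝔼} (h : v x ≤ 0) : positivityIndicator v x = 0 :=
  indicator_of_notMem (show x ∉ {y | 0 < v y} from not_lt.2 h) _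

theorem positivityIndicator_nonneg (v : 𝔼 → ℝ) (x : 𝔼) : 0 ≤ positivityIndicator v x :=
  indicator_nonneg (fun _ _ => zero_le_one) _

theorem positivityIndicator_le_one (v : 𝔼 → ℝ) (x : 𝔼) : positivityIndicator v x ≤ 1 :=
  indicator_le_self' (fun _ _ => zero_le_one) _

theorem positivityIndicator_mul_self (hv : ∀ x, 0 ≤ v x) (x : 𝔼) :
    positivityIndicator v x * v x = v x := by
  rcases (hv x).eq_or_lt with h | h
  · rw [← h, mul_zero]
  · rw [positivityIndicator_of_pos h, one_mul]

theorem integrable_positivityIndicator_mul (hv : Continuous v) {g : 𝔼 → ℝ} (hg : Integrable g) :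
    Integrable fun x => positivityIndicator v x * g x := by
  refine hg.bdd_mul (c := 1) ?_ (Eventually.of_forall fun x => ?_)
  · exact (measurable_const.indicator
      (isOpen_lt continuous_const hv).measurableSet).aestronglyMeasurable
  · rw [Real.norm_of_nonneg (positivityIndicator_nonneg v x)]
    exact positivityIndicator_le_one v x

/-- A solution of the obstacle problem in `ball 0 R`, extended to a `C^{1,1}` function on the whole
space, with the origin in its zero set. -/
structure IsLocalSolution (L R : ℝ) (v : 𝔼 → ℝ) : Prop extends IsC11Zero L v where
  nonneg : ∀ x, 0 ≤ v x
  weakLaplacianOn : WeakLaplacianOn (ball 0 R) v (positivityIndicator v)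

theorem rescaling_nonneg (hv : ∀ x, 0 ≤ v x) (x₀ : 𝔼) (r : ℝ) (x : 𝔼) :
    0 ≤ rescaling v x₀ r x :=
  div_nonneg (hv _) (sq_nonneg r)

theorem weakLaplacianOn_rescaling (hd : Differentiable ℝ v) {x₀ : 𝔼}
    (h : WeakLaplacianOn (ball x₀ R) v (positivityIndicator v)) {r : ℝ} (hr : 0 < r) :
    WeakLaplacianOn (ball 0 (R / r)) (rescaling v x₀ r)
      (positivityIndicator (rescaling v x₀ r)) := by
  have := h.comp_affine hd x₀ hr.ne' (r ^ 2)⁻¹ (V := ball 0 (R / r)) fun x hx => by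
    rw [mem_ball_zero_iff, lt_div_iff₀ hr] at hx
    rw [mem_ball, dist_eq_norm, add_sub_cancel_left, norm_smul, Real.norm_of_nonneg hr.le]
    linarith
  rw [← rescaling_eq] at this
  convert this using 1
  ext x
  rw [inv_mul_cancel₀ (by positivity), one_mul]
  rcases le_or_gt (v (x₀ + r • x)) 0 with h | h
  · rw [positivityIndicator_of_nonpos h, positivityIndicator_of_nonpos]
    exact div_nonpos_of_nonpos_of_nonneg h (sq_nonneg r)
  · rw [positivityIndicator_of_pos h, positivityIndicator_of_pos]
    exact div_pos h (by positivity)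

theorem IsLocalSolution.rescaling (h : IsLocalSolution L R v) {r : ℝ} (hr : 0 < r) :
    IsLocalSolution L (R / r) (rescaling v 0 r) where
  toIsC11Zero := h.toIsC11Zero.rescaling hr
  nonneg := rescaling_nonneg h.nonneg 0 r
  weakLaplacianOn := weakLaplacianOn_rescaling h.differentiable h.weakLaplacianOn hr

theorem closedBall_subset_ball_of_one_lt (hR : 1 < R) : closedBall (0 : 𝔼) 1 ⊆ ball 0 R :=
  closedBall_subset_ball hR

/-- Only the last term of the energy is negative, and |v| ≤ L on the unit ball. The bound is the
same for all rescalings, as they share the constant L. -/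
theorem IsC11Zero.neg_le_energy (h : IsC11Zero L v) (hv : ∀ x, 0 ≤ v x) :
    -(L ^ 2 * ∫ x : 𝔼, weight x) ≤ energy v := by
  have hc := h.contDiff.continuous
  have h1 : ∫ x, weight x * v x ^ 2 ≤ ∫ x, weight x * L ^ 2 :=
    integral_weight_mul_mono (by fun_prop) continuous_const fun x hx =>
      sq_le_sq' (abs_le.1 (h.abs_le_of_norm_le_one hx)).1 (abs_le.1 (h.abs_le_of_norm_le_one hx)).2
  rw [integral_mul_const, mul_comm] at h1
  have h2 : ∫ x, -(weight x * v x ^ 2) ≤ energy v := by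
    refine integral_mono (integrable_weight_mul (by fun_prop)).neg (integrable_energy h.contDiff)
      fun x => ?_
    have := mul_nonneg (cutoff_nonneg x) (add_nonneg (show 0 ≤ ‖∇ v x‖ ^ 2 / 2 by positivity) (hv x))
    simp only
    linarith
  rw [integral_neg] at h2
  linarith

/-- Infinitesimal form of Weiss' monotonicity formula. -/
theorem IsLocalSolution.le_energy_rescaling (h : IsLocalSolution L R v) (hR : 1 < R) {t : ℝ}
    (h1 : 1 ≤ t) (h2 : t ≤ 2) :
    energy v + (t - 1) * (∫ x, weight x * eulerDefect v x ^ 2)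
      - 229 * L ^ 2 * (∫ x : 𝔼, weight x) * (t - 1) ^ 2 ≤ energy (_root_.rescaling v 0 t) := by
  set w := _root_.rescaling v 0 t with hw
  have hwC : IsC11Zero L w := h.toIsC11Zero.rescaling (by linarith)
  have hvc := h.contDiff.continuous
  have hwc := hwC.contDiff.continuous
  have hev := continuous_eulerDefect h.contDiff
  have key := energy_sub_energy (closedBall_subset_ball_of_one_lt hR) h.contDiff hwC.contDiff
    h.weakLaplacianOn
  have i1 : Integrable fun x => cutoff x * (w x - v x) := integrable_cutoff_mul (by fun_prop)
  -- The obstacle enters here: off the positivity set v = 0 and w ≥ 0, so the variation has the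
  -- favourable sign.
  have e1 : ∫ x, positivityIndicator v x * (cutoff x * (w x - v x))
      ≤ ∫ x, cutoff x * (w x - v x) := by
    refine integral_mono (integrable_positivityIndicator_mul hvc i1) i1 fun x => ?_
    simp only
    rcases (h.nonneg x).eq_or_lt with h0 | h0
    · rw [positivityIndicator_of_nonpos h0.ge, zero_mul, ← h0, sub_zero]
      exact mul_nonneg (cutoff_nonneg x) (rescaling_nonneg h.nonneg 0 t x)
    · rw [positivityIndicator_of_pos h0, one_mul]
  have e2 : 0 ≤ ∫ x, cutoff x * ‖∇ w x - ∇ v x‖ ^ 2 :=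
    integral_nonneg fun x => mul_nonneg (cutoff_nonneg x) (sq_nonneg _)
  -- This contributes 14² = 196; with the 33 = 11·3 of the next estimate it makes 229.
  have e3 : ∫ x, weight x * (w x - v x) ^ 2 ≤ ∫ x, weight x * (14 * L * (t - 1)) ^ 2 :=
    integral_weight_mul_mono (by fun_prop) continuous_const fun x hx =>
      sq_le_sq' (abs_le.1 (h.abs_rescaling_sub_le' h1 h2 hx)).1
        (abs_le.1 (h.abs_rescaling_sub_le' h1 h2 hx)).2
  have e4 : ∫ x, weight x * ((t - 1) * eulerDefect v x ^ 2 - 33 * L ^ 2 * (t - 1) ^ 2)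
      ≤ ∫ x, weight x * ((w x - v x) * eulerDefect v x) := by
    refine integral_weight_mul_mono (by fun_prop) (by fun_prop) fun x hx => ?_
    have b1 := h.abs_rescaling_sub_le h1 h2 hx
    have b2 := h.abs_eulerDefect_le hx
    have b3 : |(w x - v x - (t - 1) * eulerDefect v x) * eulerDefect v x|
        ≤ 11 * L * (t - 1) ^ 2 * (3 * L) := by
      rw [abs_mul]
      exact mul_le_mul b1 b2 (abs_nonneg _) ((abs_nonneg _).trans b1)
    have := (abs_le.1 b3).1
    nlinarith
  have e5 : ∫ x, weight x * ((t - 1) * eulerDefect v x ^ 2 - 33 * L ^ 2 * (t - 1) ^ 2)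
      = (t - 1) * (∫ x, weight x * eulerDefect v x ^ 2)
        - 33 * L ^ 2 * (t - 1) ^ 2 * ∫ x : 𝔼, weight x := by
    rw [← integral_const_mul, ← integral_const_mul, ← integral_sub
      ((integrable_weight_mul (by fun_prop)).const_mul _) (integrable_weight.const_mul _)]
    congr 1 with x
    ring
  rw [integral_mul_const] at e3
  nlinarith

/-- The infinitesimal form of Monneau's monotonicity formula. -/
theorem IsLocalSolution.two_mul_energy_sub_le (h : IsLocalSolution L R v) (hR : 1 < R)
    {A : Matrix (Fin n) (Fin n) ℝ} (hA : A.PosSemidef) (htr : A.trace = 1) :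
    2 * (energy v - polyEnergy n)
      ≤ ∫ x, weight x * ((v x - quadraticPoly A x) * eulerDefect v x) := by
  have hH := hA.isHermitian
  have hp := contDiff_quadraticPoly hH
  have hpc := hp.continuous
  have hvc := h.contDiff.continuous
  have hgv := continuous_gradient h.contDiff
  have hgp := continuous_gradient hp
  have hpw := weakLaplacianOn_quadraticPoly hH univ
  rw [htr] at hpw
  set p := quadraticPoly A with hpdef
  have hp0 : ∀ x, 0 ≤ p x := fun x => by
    have := hA.dotProduct_mulVec_nonneg x.ofLp
    rw [star_trivial, dotProduct_comm] at this
    rw [hpdef, quadraticPoly]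
    positivity
  -- Expanding at p, where the defect vanishes and the right-hand side is 1, leaves only the
  -- quadratic part in v - p.
  have k1 := energy_sub_energy (subset_univ _) hp h.contDiff hpw
  rw [energy_quadraticPoly hH htr] at k1
  simp only [hpdef, eulerDefect_quadraticPoly hH, mul_zero, integral_zero, add_zero, one_mul,
    sub_self, zero_add] at k1
  rw [← hpdef] at k1
  have k2 := integral_cutoff_mul_inner_gradient (closedBall_subset_ball_of_one_lt hR)
    (h.contDiff.sub hp) (h.contDiff.sub hp) (h.weakLaplacianOn.sub h.contDiff hp
      (hpw.mono (subset_univ _))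
      (fun ζ hζ hc => integrable_positivityIndicator_mul hvc (hζ.integrable_of_hasCompactSupport hc))
      (fun ζ hζ hc => by simpa using hζ.integrable_of_hasCompactSupport hc))
  simp_rw [gradient_sub' h.contDiff hp, real_inner_self_eq_norm_sq] at k2
  -- The integrand is zero where v > 0, and equals φp ≥ 0 where v = 0. This is the use of
  -- nonnegativity of the matrix.
  have k3 : 0 ≤ ∫ x, (positivityIndicator v x - 1) * (cutoff x * (v x - p x)) := by
    refine integral_nonneg fun x => ?_
    simp only [Pi.zero_apply]
    rcases (h.nonneg x).eq_or_lt with h0 | h0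
    · rw [positivityIndicator_of_nonpos h0.ge, ← h0]
      nlinarith [mul_nonneg (cutoff_nonneg x) (hp0 x)]
    · rw [positivityIndicator_of_pos h0, sub_self, zero_mul]
  have k4 : ∫ x, weight x * ((v x - p x) * eulerDefect v x)
      = (∫ x, weight x * ((v x - p x) * inner ℝ x (∇ v x - ∇ p x)))
        - 2 * ∫ x, weight x * (v x - p x) ^ 2 := by
    rw [← integral_const_mul, ← integral_sub (integrable_weight_mul (by fun_prop))
      ((integrable_weight_mul (by fun_prop)).const_mul _)]
    congr 1 with x
    rw [inner_sub_right, inner_gradient_quadraticPoly hH, eulerDefect]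
    ring
  rw [k4]
  linarith

/-- Convexity of the square gives (w - p)² ≥ (v - p)² + 2(w - v)(v - p), and w - v is (t - 1)e(v) to
first order. The resulting linear term is nonnegative by the previous lemma and the energy bound. -/
theorem IsLocalSolution.le_integral_rescaling (h : IsLocalSolution L R v) (hR : 1 < R)
    {A : Matrix (Fin n) (Fin n) ℝ} (hA : A.PosSemidef) (htr : A.trace = 1) {B : ℝ}
    (hB : ∀ x : 𝔼, ‖x‖ ≤ 1 → |quadraticPoly A x| ≤ B) (hE : polyEnergy n ≤ energy v) {t : ℝ}
    (h1 : 1 ≤ t) (h2 : t ≤ 2) :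
    (∫ x, weight x * (v x - quadraticPoly A x) ^ 2)
      - 22 * L * (L + B) * (∫ x : 𝔼, weight x) * (t - 1) ^ 2
      ≤ ∫ x, weight x * (_root_.rescaling v 0 t x - quadraticPoly A x) ^ 2 := by
  have hpc := (contDiff_quadraticPoly hA.isHermitian).continuous
  have hvc := h.contDiff.continuous
  have hev := continuous_eulerDefect h.contDiff
  have hwc := (h.toIsC11Zero.rescaling (show 0 < t by linarith)).contDiff.continuous
  have k := h.two_mul_energy_sub_le hR hA htr
  set p := quadraticPoly A
  set w := _root_.rescaling v 0 t
  have e1 : ∫ x, weight x * ((v x - p x) ^ 2 + (2 * (t - 1) * ((v x - p x) * eulerDefect v x)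
        - 22 * L * (L + B) * (t - 1) ^ 2)) ≤ ∫ x, weight x * (w x - p x) ^ 2 := by
    refine integral_weight_mul_mono (by fun_prop) (by fun_prop) fun x hx => ?_
    have b1 := h.abs_rescaling_sub_le h1 h2 hx
    have b2 : |v x - p x| ≤ L + B :=
      (abs_sub _ _).trans (add_le_add (h.abs_le_of_norm_le_one hx) (hB x hx))
    have b3 : |(w x - v x - (t - 1) * eulerDefect v x) * (v x - p x)|
        ≤ 11 * L * (t - 1) ^ 2 * (L + B) := by
      rw [abs_mul]
      exact mul_le_mul b1 b2 (abs_nonneg _) ((abs_nonneg _).trans b1)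
    have := (abs_le.1 b3).1
    nlinarith [sq_nonneg (w x - v x)]
  have e2 : ∫ x, weight x * ((v x - p x) ^ 2 + (2 * (t - 1) * ((v x - p x) * eulerDefect v x)
        - 22 * L * (L + B) * (t - 1) ^ 2)) = (∫ x, weight x * (v x - p x) ^ 2)
      + (2 * (t - 1) * (∫ x, weight x * ((v x - p x) * eulerDefect v x))
        - 22 * L * (L + B) * (t - 1) ^ 2 * ∫ x : 𝔼, weight x) := by
    have i1 : Integrable fun x => 2 * (t - 1) * (weight x * ((v x - p x) * eulerDefect v x)) :=
      (integrable_weight_mul (by fun_prop)).const_mul _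
    have i2 : Integrable fun x : 𝔼 => 22 * L * (L + B) * (t - 1) ^ 2 * weight x :=
      integrable_weight.const_mul _
    have i3 : Integrable fun x => weight x * (v x - p x) ^ 2 := integrable_weight_mul (by fun_prop)
    rw [← integral_const_mul, ← integral_const_mul, ← integral_sub i1 i2,
      ← integral_add i3 (i1.sub' i2)]
    congr 1 with x
    ring
  rw [e2] at e1
  have : 0 ≤ (t - 1) * ∫ x, weight x * ((v x - p x) * eulerDefect v x) :=
    mul_nonneg (by linarith) (by linarith)
  linarith

/-- The truncated Weiss energy of every rescaling is at least that of the blow-up polynomials. -/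
def EnergyBounded (R : ℝ) (v : 𝔼 → ℝ) : Prop :=
  ∀ r, 0 < r → r < R → polyEnergy n ≤ energy (rescaling v 0 r)

theorem one_lt_div_of_mul_lt {r t R : ℝ} (hr : 0 < r) (h1 : 1 ≤ t) (h : r * t < R) : 1 < R / r := by
  rw [lt_div_iff₀ hr]
  nlinarith

/-- Weiss' monotonicity: each rescaling is again a solution with the same L, so the infinitesimal
inequality holds at every scale with one constant. -/
theorem IsLocalSolution.energy_mono (h : IsLocalSolution L R v) {a b : ℝ} (ha : 0 < a)
    (hab : a ≤ b) (hb : b < R) :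
    energy (_root_.rescaling v 0 a) ≤ energy (_root_.rescaling v 0 b) := by
  refine le_of_forall_sub_sq_le_mul (C := 229 * L ^ 2 * ∫ x : 𝔼, weight x)
    (F := fun r => energy (_root_.rescaling v 0 r))
    (mul_nonneg (by positivity) integral_weight_pos.le) (fun r t hr h1 h2 hrt => ?_) ha hab hb
  have := (h.rescaling hr).le_energy_rescaling (one_lt_div_of_mul_lt hr h1 hrt) h1 h2
  rw [← rescaling_mul] at this
  have h3 : 0 ≤ (t - 1) * ∫ x, weight x * eulerDefect (_root_.rescaling v 0 r) x ^ 2 :=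
    mul_nonneg (by linarith)
      (integral_nonneg fun x => mul_nonneg (weight_nonneg x) (sq_nonneg _))
  linarith

/-- Along the rescalings of a solution the Euler defect tends to zero. -/
theorem IsLocalSolution.tendsto_eulerDefect (h : IsLocalSolution L R v) (hR : 0 < R) :
    Tendsto (fun r => ∫ x, weight x * eulerDefect (_root_.rescaling v 0 r) x ^ 2)
      (𝓝[>] 0) (𝓝 0) := by
  refine tendsto_zero_of_forall_mul_le_sub (C := 229 * L ^ 2 * ∫ x : 𝔼, weight x)
    (F := fun r => energy (_root_.rescaling v 0 r)) (B := -(L ^ 2 * ∫ x : 𝔼, weight x))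
    (mul_nonneg (by positivity) integral_weight_pos.le) hR
    (fun r hr _ => (h.rescaling hr).neg_le_energy (h.rescaling hr).nonneg)
    (fun r => integral_nonneg fun x => mul_nonneg (weight_nonneg x) (sq_nonneg _))
    (fun r t hr h1 h2 hrt => ?_)
  have := (h.rescaling hr).le_energy_rescaling (one_lt_div_of_mul_lt hr h1 hrt) h1 h2
  rwa [← rescaling_mul] at this

theorem exists_forall_abs_le {f : 𝔼 → ℝ} (hf : Continuous f) (ρ : ℝ) :
    ∃ B, 0 ≤ B ∧ ∀ x : 𝔼, ‖x‖ ≤ ρ → |f x| ≤ B := by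
  obtain ⟨B, hB⟩ := (isCompact_closedBall (0 : 𝔼) ρ).exists_bound_of_continuousOn hf.continuousOn
  exact ⟨max B 0, le_max_right _ _, fun x hx => (hB x (by simpa using hx)).trans (le_max_left _ _)⟩

/-- Monneau's monotonicity formula. -/
theorem IsLocalSolution.monneau_mono (h : IsLocalSolution L R v) (hE : EnergyBounded R v)
    {A : Matrix (Fin n) (Fin n) ℝ} (hA : A.PosSemidef) (htr : A.trace = 1) {a b : ℝ} (ha : 0 < a)
    (hab : a ≤ b) (hb : b < R) :
    ∫ x, weight x * (_root_.rescaling v 0 a x - quadraticPoly A x) ^ 2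
      ≤ ∫ x, weight x * (_root_.rescaling v 0 b x - quadraticPoly A x) ^ 2 := by
  obtain ⟨B, hB0, hB⟩ :=
    exists_forall_abs_le (contDiff_quadraticPoly hA.isHermitian).continuous 1
  have hL := h.nonneg_const
  refine le_of_forall_sub_sq_le_mul (C := 22 * L * (L + B) * ∫ x : 𝔼, weight x)
    (F := fun r => ∫ x, weight x * (_root_.rescaling v 0 r x - quadraticPoly A x) ^ 2)
    (mul_nonneg (by positivity) integral_weight_pos.le) (fun r t hr h1 h2 hrt => ?_) ha hab hb
  have := (h.rescaling hr).le_integral_rescaling (one_lt_div_of_mul_lt hr h1 hrt) hA htr hB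
    (hE r hr (by nlinarith)) h1 h2
  rwa [← rescaling_mul] at this

end LocalSolution

/-! ### Compactness in C¹ and convergence of integrals -/

section Compactness

variable {ι : Type*} {L : ℝ} {w : ι → EuclideanSpace ℝ (Fin n) → ℝ}
  {v q : EuclideanSpace ℝ (Fin n) → ℝ}

theorem hasGradientAt_of_abs_sub_le {g x : 𝔼} (h : ∀ d, |v (x + d) - v x - inner ℝ g d| ≤ L * ‖d‖ ^ 2) :
    HasGradientAt v g x := by
  rw [hasGradientAt_iff_isLittleO_nhds_zero]
  refine Asymptotics.IsBigO.trans_isLittleO (g := fun d : 𝔼 => ‖d‖ ^ 2) ?_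
    (Asymptotics.isLittleO_norm_pow_id one_lt_two)
  exact Asymptotics.IsBigO.of_bound L (Eventually.of_forall fun d => by
    simpa using h d)

/-- Functions in `IsC11Zero L` converge in `C¹` along ultrafilters. -/
theorem exists_tendsto_of_ultrafilter (𝒰 : Ultrafilter ι) (hw : ∀ᶠ i in 𝒰, IsC11Zero L (w i)) :
    ∃ v, IsC11Zero L v ∧ (∀ x, Tendsto (fun i => w i x) 𝒰 (𝓝 (v x))) ∧
      ∀ x, Tendsto (fun i => ∇ (w i) x) 𝒰 (𝓝 (∇ v x)) := by
  have h1 : ∀ x, ∃ a, Tendsto (fun i => w i x) 𝒰 (𝓝 a) := fun x => by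
    obtain ⟨a, -, ha⟩ := (isCompact_Icc (a := -(L * ‖x‖ ^ 2)) (b := L * ‖x‖ ^ 2)).ultrafilter_le_nhds
      (𝒰.map fun i => w i x) (by
        rw [le_principal_iff]
        exact hw.mono fun i hi => abs_le.1 (hi.abs_apply_le x))
    exact ⟨a, ha⟩
  have h2 : ∀ x, ∃ a, Tendsto (fun i => ∇ (w i) x) 𝒰 (𝓝 a) := fun x => by
    obtain ⟨a, -, ha⟩ := (isCompact_closedBall (0 : 𝔼) (L * ‖x‖)).ultrafilter_le_nhds
      (𝒰.map fun i => ∇ (w i) x) (by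
        rw [le_principal_iff]
        exact hw.mono fun i hi => by simpa using hi.norm_gradient_le x)
    exact ⟨a, ha⟩
  choose v hv using h1
  choose g hg using h2
  -- The Taylor estimate has a uniform constant, so it survives pointwise limits and identifies the
  -- limit of the gradients as the gradient of the limit.
  have hgrad : ∀ x, HasGradientAt v (g x) x := fun x =>
    hasGradientAt_of_abs_sub_le (L := L) fun d =>
      le_of_tendsto (((hv (x + d)).sub (hv x)).sub ((hg x).inner tendsto_const_nhds)).abs <| by
        filter_upwards [hw] with i hi
        exact abs_sub_sub_inner_gradient_le hi.differentiable hi.norm_gradient_sub_le x d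
  have hgv : ∇ v = g := gradient_eq hgrad
  obtain ⟨i₀, hi₀⟩ := hw.exists
  refine ⟨v, ⟨hi₀.nonneg_const, fun x => (hgrad x).differentiableAt, fun x y => ?_, ?_, ?_⟩, hv, ?_⟩
  · rw [hgv]
    refine le_of_tendsto ((hg x).sub (hg y)).norm ?_
    filter_upwards [hw] with i hi
    exact hi.norm_gradient_sub_le x y
  · refine tendsto_nhds_unique (hv 0) (tendsto_const_nhds.congr' ?_)
    filter_upwards [hw] with i hi
    exact hi.apply_zero.symm
  · rw [hgv]
    refine tendsto_nhds_unique (hg 0) (tendsto_const_nhds.congr' ?_)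
    filter_upwards [hw] with i hi
    exact hi.gradient_zero.symm
  · rwa [hgv]

/-- An equi-Lipschitz bound towards each centre upgrades pointwise to locally uniform convergence.
-/
theorem tendstoLocallyUniformly_of_dist_le {X Y : Type*} [PseudoMetricSpace X]
    [PseudoMetricSpace Y] {l : Filter ι} {F : ι → X → Y} {f : X → Y} (hf : Continuous f)
    (hF : ∀ x, ∃ M : ℝ, ∀ᶠ i in l, ∀ y ∈ ball x 1, dist (F i y) (F i x) ≤ M * dist y x)
    (h : ∀ x, Tendsto (fun i => F i x) l (𝓝 (f x))) : TendstoLocallyUniformly F f l := by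
  rw [Metric.tendstoLocallyUniformly_iff]
  intro ε hε x
  obtain ⟨M, hM⟩ := hF x
  have hδ : 0 < ε / (3 * (|M| + 1)) := by positivity
  refine ⟨ball x 1 ∩ ball x (ε / (3 * (|M| + 1))) ∩ f ⁻¹' ball (f x) (ε / 3), ?_, ?_⟩
  · exact inter_mem (inter_mem (ball_mem_nhds x one_pos) (ball_mem_nhds x hδ))
      (hf.continuousAt (ball_mem_nhds _ (by positivity)))
  · filter_upwards [hM, (h x).eventually (ball_mem_nhds _ (show 0 < ε / 3 by positivity))]
      with i hi hix y ⟨⟨hy1, hy2⟩, hy3⟩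
    have h1 : dist (F i y) (F i x) ≤ ε / 3 := by
      calc dist (F i y) (F i x) ≤ M * dist y x := hi y hy1
        _ ≤ (|M| + 1) * (ε / (3 * (|M| + 1))) := by
            gcongr
            · linarith [le_abs_self M]
            · exact (mem_ball.1 hy2).le
        _ = ε / 3 := by field_simp
    have h2 : dist (F i x) (f x) < ε / 3 := hix
    have h3 : dist (f y) (f x) < ε / 3 := hy3
    have h4 := dist_triangle4 (f y) (f x) (F i x) (F i y)
    rw [dist_comm (f x), dist_comm (F i x) (F i y)] at h4
    linarith

theorem IsC11Zero.dist_le (h : IsC11Zero L v) (x : 𝔼) {y : 𝔼} (hy : y ∈ ball x 1) :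
    dist (v y) (v x) ≤ (L * ‖x‖ + L) * dist y x := by
  obtain ⟨d, rfl⟩ : ∃ d, y = x + d := ⟨y - x, by abel⟩
  have hd : ‖d‖ ≤ 1 := by simpa using (mem_ball.1 hy).le
  have h1 := abs_sub_sub_inner_gradient_le h.differentiable h.norm_gradient_sub_le x d
  have h2 : |inner ℝ (∇ v x) d| ≤ L * ‖x‖ * ‖d‖ :=
    (abs_real_inner_le_norm _ _).trans (by gcongr; exact h.norm_gradient_le x)
  have h3 : L * ‖d‖ ^ 2 ≤ L * ‖d‖ := by
    have := h.nonneg_const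
    gcongr
    nlinarith [norm_nonneg d]
  rw [Real.dist_eq, dist_self_add_left]
  calc |v (x + d) - v x| = |(v (x + d) - v x - inner ℝ (∇ v x) d) + inner ℝ (∇ v x) d| := by ring_nf
    _ ≤ _ := (abs_add_le _ _).trans (add_le_add h1 h2)
    _ ≤ _ := by linarith

theorem tendstoLocallyUniformly_of_isC11Zero {l : Filter ι} (hw : ∀ᶠ i in l, IsC11Zero L (w i))
    (hv : Continuous v) (h : ∀ x, Tendsto (fun i => w i x) l (𝓝 (v x))) :
    TendstoLocallyUniformly w v l :=
  tendstoLocallyUniformly_of_dist_le hv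
    (fun x => ⟨L * ‖x‖ + L, hw.mono fun _ hi _ hy => hi.dist_le x hy⟩) h

/-- Along every ultrafilter finer than l the gradients converge to the gradient of the limit
function, which is v by uniqueness of limits. -/
theorem tendsto_gradient_of_isC11Zero {l : Filter ι} (hw : ∀ᶠ i in l, IsC11Zero L (w i))
    (h : ∀ x, Tendsto (fun i => w i x) l (𝓝 (v x))) (x : 𝔼) :
    Tendsto (fun i => ∇ (w i) x) l (𝓝 (∇ v x)) := by
  rw [tendsto_iff_ultrafilter]
  intro 𝒰 h𝒰
  obtain ⟨v', -, hv', hg⟩ := exists_tendsto_of_ultrafilter 𝒰 (hw.filter_mono h𝒰)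
  have : v' = v := funext fun y => tendsto_nhds_unique (hv' y) ((h y).mono_left h𝒰)
  exact this ▸ hg x

theorem tendstoLocallyUniformly_gradient {l : Filter ι} (hw : ∀ᶠ i in l, IsC11Zero L (w i))
    (hv : ContDiff ℝ 1 v) (h : ∀ x, Tendsto (fun i => w i x) l (𝓝 (v x))) :
    TendstoLocallyUniformly (fun i => ∇ (w i)) (∇ v) l :=
  tendstoLocallyUniformly_of_dist_le (continuous_gradient hv)
    (fun x => ⟨L, hw.mono fun _ hi y _ => by
      simpa [dist_eq_norm] using hi.norm_gradient_sub_le y x⟩)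
    (tendsto_gradient_of_isC11Zero hw h)

theorem tendstoLocallyUniformly_fderiv {l : Filter ι} (hw : ∀ᶠ i in l, IsC11Zero L (w i))
    (hv : ContDiff ℝ 1 v) (h : ∀ x, Tendsto (fun i => w i x) l (𝓝 (v x))) :
    TendstoLocallyUniformly (fun i => fderiv ℝ (w i)) (fderiv ℝ v) l := by
  have := tendstoLocallyUniformly_gradient hw hv h
  rw [Metric.tendstoLocallyUniformly_iff] at this ⊢
  intro ε hε x
  obtain ⟨t, ht, h⟩ := this ε hε x
  refine ⟨t, ht, h.mono fun i hi y hy => ?_⟩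
  have := hi y hy
  rwa [← toDual_gradient, ← toDual_gradient, LinearIsometryEquiv.dist_map]

theorem tendsto_integral_of_forall_abs_sub_le {l : Filter ι} {F : ι → 𝔼 → ℝ} {G : 𝔼 → ℝ} {K : Set 𝔼}
    (hK : IsCompact K) (hF : ∀ᶠ i in l, Continuous (F i)) (hG : Continuous G)
    (hFK : ∀ i, ∀ x ∉ K, F i x = 0) (hGK : ∀ x ∉ K, G x = 0)
    (h : ∀ ε > 0, ∀ᶠ i in l, ∀ x ∈ K, |F i x - G x| ≤ ε) :
    Tendsto (fun i => ∫ x, F i x) l (𝓝 (∫ x, G x)) := by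
  rw [Metric.tendsto_nhds]
  intro ε hε
  set m := (volume : Measure 𝔼).real K
  have hm : 0 ≤ m := measureReal_nonneg
  filter_upwards [hF, h (ε / (2 * (m + 1))) (by positivity)] with i hc hi
  rw [dist_eq_norm, ← integral_sub (hc.integrable_of_hasCompactSupport
    (HasCompactSupport.intro hK (hFK i))) (hG.integrable_of_hasCompactSupport
    (HasCompactSupport.intro hK hGK)), ← setIntegral_eq_integral_of_forall_compl_eq_zero
    (s := K) (fun x hx => by rw [hFK i x hx, hGK x hx, sub_zero])]
  calc _ ≤ ε / (2 * (m + 1)) * m :=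
        norm_setIntegral_le_of_norm_le_const hK.measure_lt_top fun x hx => hi x hx
    _ ≤ ε / (2 * (m + 1)) * (m + 1) := by gcongr; linarith
    _ = ε / 2 := by field_simp
    _ < ε := by linarith

theorem weight_eq_zero_of_notMem {x : 𝔼} (hx : x ∉ closedBall (0 : 𝔼) 1) : weight x = 0 :=
  weight_eq_zero (by simpa using (not_le.1 fun h => hx (by simpa using h)).le)

theorem weight_le_four (x : 𝔼) : weight x ≤ 4 := by
  unfold weight
  linarith [max_le_one x]

theorem eventually_abs_sub_le {l : Filter ι} (h : TendstoLocallyUniformly w v l) {K : Set 𝔼}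
    (hK : IsCompact K) {ε : ℝ} (hε : 0 < ε) : ∀ᶠ i in l, ∀ x ∈ K, |w i x - v x| ≤ ε := by
  have := (tendstoLocallyUniformlyOn_iff_tendstoUniformlyOn_of_compact hK).1
    h.tendstoLocallyUniformlyOn
  rw [Metric.tendstoUniformlyOn_iff] at this
  filter_upwards [this ε hε] with i hi x hx
  have := (hi x hx).le
  rwa [dist_comm, Real.dist_eq] at this

theorem tendsto_integral_weight_mul_sq {l : Filter ι} (hw : ∀ᶠ i in l, IsC11Zero L (w i))
    (hv : Continuous v) (hq : Continuous q) (h : ∀ x, Tendsto (fun i => w i x) l (𝓝 (v x))) :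
    Tendsto (fun i => ∫ x, weight x * (w i x - q x) ^ 2) l
      (𝓝 (∫ x, weight x * (v x - q x) ^ 2)) := by
  have hcw := continuous_weight (n := n)
  refine tendsto_integral_of_forall_abs_sub_le (isCompact_closedBall 0 1)
    (hw.mono fun i hi => ?_) (by fun_prop)
    (fun i x hx => by rw [weight_eq_zero_of_notMem hx, zero_mul])
    (fun x hx => by rw [weight_eq_zero_of_notMem hx, zero_mul]) fun ε hε => ?_
  · have := hi.contDiff.continuous
    fun_prop
  obtain ⟨B, hB0, hB⟩ := exists_forall_abs_le (hv.sub hq) 1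
  have hδ : 0 < min 1 (ε / (4 * (1 + 2 * B))) := lt_min one_pos (by positivity)
  filter_upwards [eventually_abs_sub_le (tendstoLocallyUniformly_of_isC11Zero hw hv h)
    (isCompact_closedBall 0 1) hδ] with i hi x hx
  have h1 := (hi x hx).trans (min_le_left _ _)
  have h2 := (hi x hx).trans (min_le_right _ _)
  have h3 : |v x - q x| ≤ B := hB x (by simpa using hx)
  have h4 : weight x * (w i x - q x) ^ 2 - weight x * (v x - q x) ^ 2
      = weight x * ((w i x - v x) * ((w i x - v x) + 2 * (v x - q x))) := by ring
  have h5 : |(w i x - v x) + 2 * (v x - q x)| ≤ 1 + 2 * B := by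
    refine (abs_add_le _ _).trans (add_le_add h1 ?_)
    rw [abs_mul, abs_two]
    linarith [h3]
  rw [h4, abs_mul, abs_mul, abs_of_nonneg (weight_nonneg x)]
  calc weight x * (|w i x - v x| * |(w i x - v x) + 2 * (v x - q x)|)
      ≤ 4 * (ε / (4 * (1 + 2 * B)) * (1 + 2 * B)) := by
        gcongr
        exact weight_le_four x
    _ = ε := by field_simp

theorem eq_of_integral_weight_mul_sq_eq_zero (hv : Continuous v) (hq : Continuous q)
    (h : ∫ x, weight x * (v x - q x) ^ 2 = 0) {x : 𝔼} (hx : ‖x‖ < 1) : v x = q x := by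
  by_contra hne
  have hcw := continuous_weight (n := n)
  have hpos := (show Continuous fun x => weight x * (v x - q x) ^ 2 by
    fun_prop).integral_pos_of_hasCompactSupport_nonneg_nonzero (x := x) (μ := volume)
    hasCompactSupport_weight.mul_right
    (fun x => mul_nonneg (weight_nonneg x) (sq_nonneg _))
    (mul_ne_zero (weight_pos hx).ne' (pow_ne_zero 2 (sub_ne_zero.2 hne)))
  exact hpos.ne' h

/-- Convergence in mean square of functions in `IsC11Zero L` is pointwise convergence. -/
theorem tendsto_of_tendsto_integral_weight_mul_sq {l : Filter ι}
    (hw : ∀ᶠ i in l, IsC11Zero L (w i)) (hq : Continuous q)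
    (h : Tendsto (fun i => ∫ x, weight x * (w i x - q x) ^ 2) l (𝓝 0)) {x : 𝔼} (hx : ‖x‖ < 1) :
    Tendsto (fun i => w i x) l (𝓝 (q x)) := by
  rw [tendsto_iff_ultrafilter]
  intro 𝒰 h𝒰
  obtain ⟨v, hv, hwv, -⟩ := exists_tendsto_of_ultrafilter 𝒰 (hw.filter_mono h𝒰)
  have h1 := tendsto_nhds_unique (tendsto_integral_weight_mul_sq (hw.filter_mono h𝒰)
    hv.contDiff.continuous hq hwv) (h.mono_left h𝒰)
  rw [← eq_of_integral_weight_mul_sq_eq_zero hv.contDiff.continuous hq h1 hx]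
  exact hwv x

end Compactness

/-! ### Liouville's theorem and global solutions of Δv = 1 -/

section Liouville

variable {L : ℝ} {v V : EuclideanSpace ℝ (Fin n) → ℝ}

theorem integral_weight_mul_inner_eq_zero (a : 𝔼) : ∫ x : 𝔼, weight x * inner ℝ a x = 0 := by
  have h := integral_neg_eq_self (fun x : 𝔼 => weight x * inner ℝ a x) volume
  have h2 : ∀ x : 𝔼, weight (-x) * inner ℝ a (-x) = -(weight x * inner ℝ a x) := fun x => by
    rw [weight, norm_neg, inner_neg_right, weight]; ring
  simp_rw [h2, integral_neg] at h
  linarith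

/-- Mean value property with weight ω: since ωx = -∇φ, the derivative in ρ is, up to a factor, the
weak equation of x ↦ V(y + ρx) tested with φ. At ρ = 0 it vanishes by oddness. -/
theorem integral_weight_mul_comp_affine (hV : ContDiff ℝ 1 V) {M : ℝ}
    (hM : ∀ x, ‖∇ V x‖ ≤ M) (hw : WeakLaplacianOn univ V fun _ => 0) (y : 𝔼) (ρ : ℝ) :
    ∫ x, weight x * V (y + ρ • x) = V y * ∫ x : 𝔼, weight x := by
  have hVc := hV.continuous
  have hgc := continuous_gradient hV
  have hder : ∀ ρ : ℝ, HasDerivAt (fun ρ : ℝ => ∫ x, weight x * V (y + ρ • x))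
      (∫ x, weight x * inner ℝ (∇ V (y + ρ • x)) x) ρ := fun ρ => by
    refine (hasDerivAt_integral_of_dominated_loc_of_deriv_le (s := univ)
      (F := fun ρ x => weight x * V (y + ρ • x))
      (F' := fun ρ x => weight x * inner ℝ (∇ V (y + ρ • x)) x)
      (bound := fun x => weight x * (M * ‖x‖)) univ_mem
      (Eventually.of_forall fun ρ => (integrable_weight_mul (by fun_prop)).aestronglyMeasurable)
      (integrable_weight_mul (by fun_prop))
      (integrable_weight_mul (by fun_prop)).aestronglyMeasurable
      (Eventually.of_forall fun x ρ _ => ?_) (integrable_weight_mul (by fun_prop))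
      (Eventually.of_forall fun x ρ _ => ?_)).2
    · rw [norm_mul, Real.norm_of_nonneg (weight_nonneg x)]
      refine mul_le_mul_of_nonneg_left ((norm_inner_le_norm _ _).trans ?_) (weight_nonneg x)
      gcongr
      exact hM _
    · exact (hasDerivAt_comp_lineMap (hV.differentiable one_ne_zero) y x ρ).const_mul _
  have hzero : ∀ ρ : ℝ, ∫ x, weight x * inner ℝ (∇ V (y + ρ • x)) x = 0 := fun ρ => by
    rcases eq_or_ne ρ 0 with rfl | hρ
    · simpa using integral_weight_mul_inner_eq_zero (∇ V y)
    · have hW : ContDiff ℝ 1 fun x => 1 * V (y + ρ • x) := by fun_prop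
      have key := integral_cutoff_mul_inner_gradient (subset_univ _) hW
        (contDiff_const (c := (1 : ℝ)))
        (hw.comp_affine (hV.differentiable one_ne_zero) y hρ 1 (V := univ) fun _ _ => mem_univ _)
      have hg : ∀ x, ∇ (fun x => 1 * V (y + ρ • x)) x = (1 * ρ) • ∇ V (y + ρ • x) := fun x =>
        (hasGradientAt_comp_affine ρ 1 (hV.differentiable one_ne_zero _).hasGradientAt).gradient
      simp only [gradient_fun_const, inner_zero_right, mul_zero, integral_zero, one_mul, zero_mul,
        sub_zero] at key hg
      simp only [hg, real_inner_smul_right, mul_left_comm _ ρ, integral_const_mul] at key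
      have := (mul_eq_zero.1 key.symm).resolve_left hρ
      simpa only [real_inner_comm] using this
  have hconst := is_const_of_deriv_eq_zero (fun ρ => (hder ρ).differentiableAt)
    (fun ρ => (hder ρ).deriv.trans (hzero ρ)) ρ 0
  simp only [zero_smul, add_zero] at hconst
  rw [hconst, integral_mul_const, mul_comm]

/-- Liouville's theorem for weakly harmonic functions. -/
theorem eq_apply_zero_of_weakLaplacianOn_zero (hV : ContDiff ℝ 1 V) {M B : ℝ}
    (hM : ∀ x, ‖∇ V x‖ ≤ M) (hB : ∀ x, |V x| ≤ B) (hw : WeakLaplacianOn univ V fun _ => 0)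
    (y : 𝔼) : V y = V 0 := by
  have hVc := hV.continuous
  have hcw := continuous_weight (n := n)
  have hB0 : 0 ≤ B := (abs_nonneg _).trans (hB 0)
  have hW := integral_weight_pos (n := n)
  -- Both weighted means are written over the same V(ρx), so their difference falls on a translate
  -- of the weight by y/ρ; this tends to zero as ρ → ∞ because V is bounded.
  have key : ∀ ρ : ℝ, ρ ≠ 0 → (V y - V 0) * ∫ x : 𝔼, weight x
      = ∫ x, (weight (x + -(ρ⁻¹ • y)) - weight x) * V (ρ • x) := fun ρ hρ => by
    have h1 := integral_weight_mul_comp_affine hV hM hw y ρ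
    have h2 := integral_weight_mul_comp_affine hV hM hw 0 ρ
    simp only [zero_add] at h2
    rw [← integral_add_right_eq_self _ (-(ρ⁻¹ • y))] at h1
    have h3 : ∀ x : 𝔼, y + ρ • (x + -(ρ⁻¹ • y)) = ρ • x := fun x => by
      rw [smul_add, smul_neg, smul_smul, mul_inv_cancel₀ hρ, one_smul]; abel
    simp_rw [h3] at h1
    rw [sub_mul, ← h1, ← h2, ← integral_sub]
    · congr 1 with x; ring
    · exact (show Continuous fun x : 𝔼 => weight (x + -(ρ⁻¹ • y)) * V (ρ • x) by
        fun_prop).integrable_of_hasCompactSupport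
        ((hasCompactSupport_weight.comp_homeomorph (Homeomorph.addRight (-(ρ⁻¹ • y)))).mul_right)
    · exact integrable_weight_mul (by fun_prop)
  set k : ℕ → ℝ := fun j => ((j : ℝ) + 1)⁻¹ with hk
  have hk0 : ∀ j, 0 < k j := fun j => by rw [hk]; positivity
  have hk1 : ∀ j, k j ≤ 1 := fun j => inv_le_one_of_one_le₀ (by
    linarith [Nat.cast_nonneg (α := ℝ) j])
  have hklim : Tendsto k atTop (𝓝 0) := by
    simpa [hk] using tendsto_one_div_add_atTop_nhds_zero_nat (𝕜 := ℝ)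
  have hlim : Tendsto (fun j => ∫ x, (weight (x + -(k j • y)) - weight x) * V ((k j)⁻¹ • x))
      atTop (𝓝 (∫ _ : 𝔼, (0 : ℝ))) := by
    refine tendsto_integral_of_dominated_convergence
      ((closedBall 0 (1 + ‖y‖)).indicator fun _ => 8 * B) (fun j => ?_) ?_ (fun j => ?_) ?_
    · exact Continuous.aestronglyMeasurable (by fun_prop)
    · rw [integrable_indicator_iff measurableSet_closedBall]
      exact integrableOn_const (isCompact_closedBall _ _).measure_lt_top.ne
    · refine Eventually.of_forall fun x => ?_
      by_cases hx : x ∈ closedBall (0 : 𝔼) (1 + ‖y‖)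
      · rw [indicator_of_mem hx, norm_mul]
        refine mul_le_mul ?_ (hB _) (norm_nonneg _) (by norm_num)
        rw [Real.norm_eq_abs, abs_le]
        constructor <;> linarith [weight_nonneg x, weight_nonneg (x + -(k j • y)), weight_le_four x,
          weight_le_four (x + -(k j • y))]
      · rw [indicator_of_notMem hx]
        rw [mem_closedBall_zero_iff, not_le] at hx
        have h1 : ‖k j • y‖ ≤ ‖y‖ := by
          rw [norm_smul, Real.norm_of_nonneg (hk0 j).le]
          nlinarith [norm_nonneg y, hk1 j]
        have h2 : 1 ≤ ‖x + -(k j • y)‖ := by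
          rw [← sub_eq_add_neg]
          linarith [norm_sub_norm_le x (k j • y)]
        rw [weight_eq_zero h2, weight_eq_zero (by linarith [norm_nonneg y])]
        simp
    · refine Eventually.of_forall fun x => ?_
      have h1 : Tendsto (fun j => |weight (x + -(k j • y)) - weight x| * B) atTop (𝓝 0) := by
        have h2 : Tendsto (fun j => |weight (x + -(k j • y)) - weight x| * B) atTop
            (𝓝 (|weight (x + -((0 : ℝ) • y)) - weight x| * B)) :=
          ((((hcw.tendsto _).comp (tendsto_const_nhds.add (hklim.smul_const y).neg)).sub
            tendsto_const_nhds).abs).mul_const B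
        simpa using h2
      refine squeeze_zero_norm (fun j => ?_) h1
      rw [norm_mul]
      exact mul_le_mul_of_nonneg_left (hB _) (abs_nonneg _)
  have hconst : ∀ j, ∫ x, (weight (x + -(k j • y)) - weight x) * V ((k j)⁻¹ • x)
      = (V y - V 0) * ∫ x : 𝔼, weight x := fun j => by
    rw [key (k j)⁻¹ (inv_ne_zero (hk0 j).ne'), inv_inv]
  simp_rw [hconst, integral_zero] at hlim
  have := tendsto_nhds_unique hlim tendsto_const_nhds
  linarith [(mul_eq_zero.1 this.symm).resolve_right hW.ne']

/-- The second differences of a global `C^{1,1}` solution of `Δ v = 1` are constant. -/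
theorem IsC11Zero.second_difference_eq (h : IsC11Zero L v) (hw : WeakLaplacianOn univ v fun _ => 1)
    (d y : 𝔼) : v (y + d) + v (y - d) - 2 * v y = v d + v (-d) := by
  have htr : ∀ e : 𝔼, WeakLaplacianOn univ (fun x => v (e + x)) fun _ => 1 := fun e => by
    simpa using hw.comp_affine h.differentiable e one_ne_zero 1 (V := univ) fun _ _ => mem_univ _
  have hc : ∀ e : 𝔼, ContDiff ℝ 1 fun x => v (e + x) := fun e =>
    h.contDiff.comp (contDiff_const.add contDiff_id)
  have hint : ∀ c : ℝ, ∀ ζ : 𝔼 → ℝ, Continuous ζ → HasCompactSupport ζ →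
      Integrable fun x => c * ζ x := fun c ζ hζ hcζ =>
    (hζ.integrable_of_hasCompactSupport hcζ).const_mul c
  -- The second difference is weakly harmonic; the Taylor estimate bounds it by 2L|d|², so
  -- Liouville's theorem applies.
  have hV := ((htr d).sub (hc d) h.contDiff hw (hint 1) (hint 1)).sub ((hc d).sub h.contDiff)
    (h.contDiff.sub (hc (-d))) (hw.sub h.contDiff (hc (-d)) (htr (-d)) (hint 1) (hint 1))
    (hint _) (hint _)
  simp only [sub_self] at hV
  have hCD : ContDiff ℝ 1 fun x => v (d + x) - v x - (v x - v (-d + x)) :=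
    ((hc d).sub h.contDiff).sub (h.contDiff.sub (hc (-d)))
  have hL := h.nonneg_const
  have hg : ∀ e x : 𝔼, ∇ (fun x => v (e + x)) x = ∇ v (e + x) := fun e x => by
    have := (hasGradientAt_comp_affine (y := e) (x := x) 1 1
      (h.differentiable _).hasGradientAt).gradient
    simpa using this
  have hT := abs_sub_sub_inner_gradient_le h.differentiable h.norm_gradient_sub_le
  have := eq_apply_zero_of_weakLaplacianOn_zero hCD (M := 2 * (L * ‖d‖)) (B := 2 * (L * ‖d‖ ^ 2))
    (fun x => ?_) (fun x => ?_) hV y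
  · simp only [add_zero, h.apply_zero, sub_zero, zero_sub] at this
    rw [add_comm d, add_comm (-d), ← sub_eq_add_neg] at this
    linarith
  · rw [gradient_sub' ((hc d).sub h.contDiff) (h.contDiff.sub (hc (-d))),
      gradient_sub' (hc d) h.contDiff, gradient_sub' h.contDiff (hc (-d)), hg, hg, two_mul]
    refine (norm_sub_le _ _).trans (add_le_add ?_ ?_)
    · simpa using h.norm_gradient_sub_le (d + x) x
    · simpa using h.norm_gradient_sub_le x (-d + x)
  · have h1 := hT x d
    have h2 := hT x (-d)
    rw [norm_neg, inner_neg_right] at h2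
    rw [add_comm d, add_comm (-d)]
    rw [abs_le] at *
    constructor <;> linarith [h1.1, h1.2, h2.1, h2.2]

theorem IsC11Zero.eq_inner_of_gradient_eq (h : IsC11Zero L v) {T : 𝔼 →L[ℝ] 𝔼}
    (hT : ∀ x, ∇ v x = T x) (x : 𝔼) : v x = 1 / 2 * inner ℝ (T x) x := by
  have hd : ∀ t : ℝ, HasDerivAt (fun t : ℝ => v (0 + t • x) - t ^ 2 * (1 / 2 * inner ℝ (T x) x))
      0 t := fun t => by
    have := (hasDerivAt_comp_lineMap h.differentiable 0 x t).sub
      ((hasDerivAt_pow 2 t).mul_const (1 / 2 * inner ℝ (T x) x))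
    refine this.congr_deriv ?_
    rw [hT, zero_add, map_smul, real_inner_smul_left]
    norm_num
    ring
  have := is_const_of_deriv_eq_zero (fun t => (hd t).differentiableAt) (fun t => (hd t).deriv) 1 0
  simp [h.apply_zero] at this
  linarith

/-- Only the symmetric part of T contributes to the quadratic form, so symmetry of the linear
gradient map need not be proved. -/
theorem quadraticPoly_symmetrize (T : 𝔼 →L[ℝ] 𝔼) (x : 𝔼) :
    quadraticPoly ((1 / 2 : ℝ) • (((Matrix.toEuclideanCLM (n := Fin n) (𝕜 := ℝ)).symm T)
      + ((Matrix.toEuclideanCLM (n := Fin n) (𝕜 := ℝ)).symm T).transpose)) x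
      = 1 / 2 * inner ℝ (T x) x := by
  set M := (Matrix.toEuclideanCLM (n := Fin n) (𝕜 := ℝ)).symm T with hM
  have h1 : quadraticPoly M x = 1 / 2 * inner ℝ (T x) x := by
    rw [quadraticPoly_eq_inner, hM, StarAlgEquiv.apply_symm_apply]
  have h2 : quadraticPoly M.transpose x = quadraticPoly M x := by
    rw [quadraticPoly, quadraticPoly, Matrix.mulVec_transpose, ← Matrix.dotProduct_mulVec,
      dotProduct_comm]
  rw [← h1]
  unfold quadraticPoly at h2 ⊢
  rw [Matrix.smul_mulVec, Matrix.add_mulVec, smul_dotProduct, add_dotProduct, smul_eq_mul]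
  linarith

/-- Global nonnegative `C^{1,1}` solutions of `Δ v = 1` with a zero at the origin are quadratic
polynomials. -/
theorem IsC11Zero.mem_blowupPolynomials (h : IsC11Zero L v) (hv : ∀ x, 0 ≤ v x)
    (hw : WeakLaplacianOn univ v fun _ => 1) :
    ∃ A : Matrix (Fin n) (Fin n) ℝ, A.PosSemidef ∧ A.trace = 1 ∧ v = quadraticPoly A := by
  -- Differentiating the constancy of the second difference gives ∇v(m + d) + ∇v(m - d) = 2∇v(m).
  -- Preservation of midpoints, continuity and ∇v(0) = 0 then make the gradient linear.
  have hmid : ∀ x y, ∇ v (midpoint ℝ x y) = midpoint ℝ (∇ v x) (∇ v y) := fun a b => by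
    set d := (1 / 2 : ℝ) • (a - b)
    have hfun : (fun y => v (d + y) - v y) = fun y => (v y - v (-d + y)) + (v d + v (-d)) := by
      ext y
      have := h.second_difference_eq hw d y
      rw [add_comm d, add_comm (-d), ← sub_eq_add_neg]
      linarith
    have hg : ∀ e x : 𝔼, HasGradientAt (fun x => v (e + x)) (∇ v (e + x)) x := fun e x => by
      have := hasGradientAt_comp_affine (y := e) (x := x) 1 1 (h.differentiable _).hasGradientAt
      simpa using this
    set m := midpoint ℝ a b with hm
    have g1 := hasGradientAt_sub (hg d m) (h.differentiable m).hasGradientAt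
    have g2 := hasGradientAt_add (hasGradientAt_sub (h.differentiable m).hasGradientAt (hg (-d) m))
      (hasGradientAt_const m (v d + v (-d)))
    rw [hfun] at g1
    have hEq := g1.unique g2
    have ha : d + m = a := by
      rw [hm, midpoint_eq_smul_add, invOf_eq_inv]; simp only [d]; module
    have hb : -d + m = b := by
      rw [hm, midpoint_eq_smul_add, invOf_eq_inv]; simp only [d]; module
    rw [ha, hb, add_zero] at hEq
    rw [midpoint_eq_smul_add, invOf_eq_inv, eq_inv_smul_iff₀ two_ne_zero, two_smul]
    rw [sub_eq_sub_iff_add_eq_add] at hEq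
    rw [← hEq]
  set T := (AddMonoidHom.ofMapMidpoint ℝ ℝ (∇ v) h.gradient_zero hmid).toRealLinearMap
    (continuous_gradient h.contDiff) with hT
  have hv2 := h.eq_inner_of_gradient_eq (T := T) fun x => rfl
  set A := (1 / 2 : ℝ) • (((Matrix.toEuclideanCLM (n := Fin n) (𝕜 := ℝ)).symm T)
    + ((Matrix.toEuclideanCLM (n := Fin n) (𝕜 := ℝ)).symm T).transpose) with hA
  have hvA : v = quadraticPoly A := funext fun x => by rw [hv2 x, quadraticPoly_symmetrize]
  have hH : A.IsHermitian := by
    rw [Matrix.IsHermitian, Matrix.conjTranspose_eq_transpose_of_trivial, hA]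
    simp [add_comm]
  refine ⟨A, Matrix.PosSemidef.of_dotProduct_mulVec_nonneg hH fun x => ?_, ?_, hvA⟩
  · have := hv (WithLp.toLp 2 x)
    rw [hvA, quadraticPoly] at this
    rw [star_trivial, dotProduct_comm]
    simpa using this
  -- The trace is read off by testing both equations for v, with right-hand sides tr A and 1, with
  -- the same φ.
  · have h1 := weakLaplacianOn_quadraticPoly hH univ cutoff contDiff_cutoff
      hasCompactSupport_cutoff (subset_univ _)
    have h2 := hw cutoff contDiff_cutoff hasCompactSupport_cutoff (subset_univ _)
    rw [hvA, h1, neg_inj, integral_const_mul, integral_const_mul] at h2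
    exact mul_right_cancel₀ integral_cutoff_pos.ne' h2

end Liouville

/-! ### Existence and uniqueness of the blow-up -/

section BlowUp

variable {ι : Type*} {L R : ℝ} {w : ι → EuclideanSpace ℝ (Fin n) → ℝ}
  {v : EuclideanSpace ℝ (Fin n) → ℝ}

theorem cutoff_le_one (x : 𝔼) : cutoff x ≤ 1 := by
  unfold cutoff
  exact pow_le_one₀ (le_max_left _ _) (max_le_one x)

theorem eventually_norm_gradient_sub_le {l : Filter ι} (hw : ∀ᶠ i in l, IsC11Zero L (w i))
    (hv : ContDiff ℝ 1 v) (h : ∀ x, Tendsto (fun i => w i x) l (𝓝 (v x))) {K : Set 𝔼}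
    (hK : IsCompact K) {ε : ℝ} (hε : 0 < ε) :
    ∀ᶠ i in l, ∀ x ∈ K, ‖∇ (w i) x - ∇ v x‖ ≤ ε := by
  have := (tendstoLocallyUniformlyOn_iff_tendstoUniformlyOn_of_compact hK).1
    (tendstoLocallyUniformly_gradient hw hv h).tendstoLocallyUniformlyOn
  rw [Metric.tendstoUniformlyOn_iff] at this
  filter_upwards [this ε hε] with i hi x hx
  have := (hi x hx).le
  rwa [dist_comm, dist_eq_norm] at this

theorem tendsto_energy {l : Filter ι} (hw : ∀ᶠ i in l, IsC11Zero L (w i)) (hv : IsC11Zero L v)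
    (h : ∀ x, Tendsto (fun i => w i x) l (𝓝 (v x))) :
    Tendsto (fun i => energy (w i)) l (𝓝 (energy v)) := by
  have hcw := continuous_weight (n := n)
  have hcc := continuous_cutoff (n := n)
  have hL := hv.nonneg_const
  have hcont : ∀ w : 𝔼 → ℝ, IsC11Zero L w → Continuous fun x =>
      cutoff x * (‖∇ w x‖ ^ 2 / 2 + w x) - weight x * w x ^ 2 := fun w hw => by
    have h1 := hw.contDiff.continuous
    have h2 := continuous_gradient hw.contDiff
    fun_prop
  have hzero : ∀ w : 𝔼 → ℝ, ∀ x ∉ closedBall (0 : 𝔼) 1,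
      cutoff x * (‖∇ w x‖ ^ 2 / 2 + w x) - weight x * w x ^ 2 = 0 := fun w x hx => by
    have h1 := weight_eq_zero_of_notMem hx
    have h2 : cutoff x = 0 := le_antisymm (h1 ▸ cutoff_le_weight x) (cutoff_nonneg x)
    rw [h1, h2]; ring
  refine tendsto_integral_of_forall_abs_sub_le (isCompact_closedBall 0 1)
    (hw.mono fun i hi => hcont _ hi) (hcont v hv) (fun i => hzero (w i)) (hzero v) fun ε hε => ?_
  have hδ : 0 < ε / (9 * L + 1) := by positivity
  filter_upwards [hw, eventually_abs_sub_le (tendstoLocallyUniformly_of_isC11Zero hw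
    hv.contDiff.continuous h) (isCompact_closedBall 0 1) hδ,
    eventually_norm_gradient_sub_le hw hv.contDiff h (isCompact_closedBall 0 1) hδ]
    with i hi h1 h2 x hx
  have hx1 : ‖x‖ ≤ 1 := by simpa using hx
  set δ := ε / (9 * L + 1)
  have a1 := h1 x hx
  have a2 : |‖∇ (w i) x‖ - ‖∇ v x‖| ≤ δ := (abs_norm_sub_norm_le _ _).trans (h2 x hx)
  have hLx : L * ‖x‖ ≤ L := mul_le_of_le_one_right hL hx1
  have a3 : |‖∇ (w i) x‖ + ‖∇ v x‖| ≤ L + L := by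
    rw [abs_of_nonneg (by positivity)]
    exact add_le_add ((hi.norm_gradient_le x).trans hLx) ((hv.norm_gradient_le x).trans hLx)
  have a4 : |w i x + v x| ≤ L + L := (abs_add_le _ _).trans
    (add_le_add (hi.abs_le_of_norm_le_one hx1) (hv.abs_le_of_norm_le_one hx1))
  have b1 : |(‖∇ (w i) x‖ - ‖∇ v x‖) * (‖∇ (w i) x‖ + ‖∇ v x‖)| ≤ δ * (L + L) := by
    rw [abs_mul]; gcongr
  have b2 : |(w i x - v x) * (w i x + v x)| ≤ δ * (L + L) := by
    rw [abs_mul]; gcongr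
  have e : cutoff x * (‖∇ (w i) x‖ ^ 2 / 2 + w i x) - weight x * w i x ^ 2
      - (cutoff x * (‖∇ v x‖ ^ 2 / 2 + v x) - weight x * v x ^ 2)
      = cutoff x * ((‖∇ (w i) x‖ - ‖∇ v x‖) * (‖∇ (w i) x‖ + ‖∇ v x‖) / 2 + (w i x - v x))
        - weight x * ((w i x - v x) * (w i x + v x)) := by ring
  rw [e]
  refine (abs_sub _ _).trans ?_
  rw [abs_mul, abs_mul, abs_of_nonneg (weight_nonneg x), abs_of_nonneg (cutoff_nonneg x)]
  calc _ ≤ 1 * (δ * (L + L) / 2 + δ) + 4 * (δ * (L + L)) := by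
        gcongr
        · exact cutoff_le_one x
        · refine (abs_add_le _ _).trans (add_le_add ?_ a1)
          rw [abs_div, abs_two]
          gcongr
        · exact weight_le_four x
    _ = δ * (9 * L + 1) := by ring
    _ = ε := by simp only [δ]; field_simp

theorem IsLocalSolution.tendsto_abs_eulerDefect (h : IsLocalSolution L R v) (hR : 0 < R) :
    Tendsto (fun r => ∫ x, weight x * |eulerDefect (_root_.rescaling v 0 r) x|)
      (𝓝[>] 0) (𝓝 0) := by
  set W := ∫ x : 𝔼, weight x
  have hW : 0 < W := integral_weight_pos
  rw [Metric.tendsto_nhds]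
  intro ε hε
  set δ := ε / (2 * (W + 1)) with hδ
  have hδ0 : 0 < δ := by positivity
  filter_upwards [self_mem_nhdsWithin, (h.tendsto_eulerDefect hR).eventually
    (gt_mem_nhds (show 0 < δ ^ 2 by positivity))] with r hr hD
  have hev := continuous_eulerDefect (h.rescaling (mem_Ioi.1 hr)).contDiff
  set e := eulerDefect (_root_.rescaling v 0 r)
  -- Young's inequality passes from the weighted L² norm of the defect to its L¹ norm.
  have h1 : ∫ x, weight x * |e x| ≤ ∫ x, weight x * (δ + δ⁻¹ * e x ^ 2) := by
    refine integral_weight_mul_mono (by fun_prop) (by fun_prop) fun x _ => ?_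
    have h2 : δ * (δ + δ⁻¹ * e x ^ 2) = δ ^ 2 + |e x| ^ 2 := by
      rw [sq_abs]; field_simp
    refine le_of_mul_le_mul_left ?_ hδ0
    rw [h2]
    nlinarith [sq_nonneg (δ - |e x|), abs_nonneg (e x)]
  have h2 : ∫ x, weight x * (δ + δ⁻¹ * e x ^ 2) = δ * W + δ⁻¹ * ∫ x, weight x * e x ^ 2 := by
    rw [← integral_const_mul, ← integral_const_mul, ← integral_add (integrable_weight.const_mul _)
      ((integrable_weight_mul (by fun_prop)).const_mul _)]
    congr 1 with x
    ring
  have h3 : δ⁻¹ * ∫ x, weight x * e x ^ 2 ≤ δ⁻¹ * δ ^ 2 := by gcongr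
  have h4 : δ⁻¹ * δ ^ 2 = δ := by field_simp
  rw [Real.dist_eq, sub_zero, abs_of_nonneg (integral_nonneg fun x =>
    mul_nonneg (weight_nonneg x) (abs_nonneg _))]
  have h5 : δ * (W + 1) = ε / 2 := by rw [hδ]; field_simp
  linarith

theorem abs_integral_mul_le {g f e : 𝔼 → ℝ} {C : ℝ} (hg : Continuous g) (he : Continuous e)
    (h : ∀ x, ‖x‖ ≤ 1 → |f x| ≤ C) (hgw : ∀ x, |g x| ≤ weight x) (hf : Continuous f) :
    |∫ x, g x * (f x * e x)| ≤ C * ∫ x, weight x * |e x| := by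
  rw [← integral_const_mul]
  refine (abs_integral_le_integral_abs).trans ?_
  refine integral_mono ?_ ((integrable_weight_mul (by fun_prop)).const_mul C) fun x => ?_
  · refine (Continuous.integrable_of_hasCompactSupport (by fun_prop)
      (HasCompactSupport.intro (isCompact_closedBall (0 : 𝔼) 1) fun x hx => ?_)).abs
    have := hgw x
    rw [weight_eq_zero_of_notMem hx] at this
    rw [abs_nonpos_iff.1 this, zero_mul]
  · simp only [abs_mul]
    rcases le_total ‖x‖ 1 with hx | hx
    · calc |g x| * (|f x| * |e x|) ≤ weight x * (C * |e x|) := by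
            gcongr
            · exact weight_nonneg x
            · exact hgw x
            · exact h x hx
        _ = C * (weight x * |e x|) := by ring
    · have := hgw x
      rw [weight_eq_zero hx] at this
      rw [weight_eq_zero hx, le_antisymm this (abs_nonneg _)]
      simp

/-- If the energy does not drop below that of the blow-up polynomials, then the zero set has
density zero at the origin. -/
theorem IsLocalSolution.tendsto_zero_set (h : IsLocalSolution L R v) (hR : 0 < R)
    (hE : EnergyBounded R v) :
    Tendsto (fun r => ∫ x, (1 - positivityIndicator (_root_.rescaling v 0 r) x) * cutoff x)
      (𝓝[>] 0) (𝓝 0) := by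
  have hlim := (h.tendsto_abs_eulerDefect hR).const_mul (2 * (n + 6) * L + 3)
  rw [mul_zero] at hlim
  refine squeeze_zero' (Eventually.of_forall fun r => integral_nonneg fun x =>
    mul_nonneg (sub_nonneg.2 (positivityIndicator_le_one _ x)) (cutoff_nonneg x)) ?_ hlim
  filter_upwards [Ioo_mem_nhdsGT hR] with r hr
  have hs := h.rescaling hr.1
  have hR' : 1 < R / r := (one_lt_div hr.1).2 hr.2
  have hvc := hs.contDiff.continuous
  have hec := continuous_eulerDefect hs.contDiff
  have hEr := hE r hr.1 hr.2
  set w := _root_.rescaling v 0 r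
  have key := integral_mul_cutoff_eq (closedBall_subset_ball_of_one_lt hR') hs.contDiff
    hs.weakLaplacianOn (positivityIndicator_mul_self hs.nonneg)
  have e1 : ∫ x, (1 - positivityIndicator w x) * cutoff x
      = (∫ x : 𝔼, cutoff x) - ∫ x, positivityIndicator w x * cutoff x := by
    rw [← integral_sub integrable_cutoff
      (integrable_positivityIndicator_mul hvc integrable_cutoff)]
    congr 1 with x
    ring
  have e2 : ∫ x : 𝔼, cutoff x = 4 * (n + 6) * polyEnergy n := by
    rw [polyEnergy]; field_simp
  have hcut : ∀ x : 𝔼, |cutoff x| ≤ weight x := fun x => by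
    rw [abs_of_nonneg (cutoff_nonneg x)]; exact cutoff_le_weight x
  have hwt : ∀ x : 𝔼, |weight x| ≤ weight x := fun x => (abs_of_nonneg (weight_nonneg x)).le
  have b1 := abs_integral_mul_le continuous_weight hec (fun x hx => hs.abs_le_of_norm_le_one hx)
    hwt hvc
  have b2 := abs_integral_mul_le (f := fun _ => 1) (C := 1) continuous_cutoff hec
    (fun x hx => by simp) hcut continuous_const
  have b3 := abs_integral_mul_le (f := fun _ => 1) (C := 1) continuous_weight hec
    (fun x hx => by simp) hwt continuous_const
  simp only [one_mul] at b2 b3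
  -- The φ-mass of the zero set is 4(n+6) times `polyEnergy` minus the energy, a nonpositive
  -- quantity, plus defect terms bounded by 2(n+6)L, 2 and 1 times ∫ω|e|.
  rw [e1, e2, key]
  have hn : (0 : ℝ) ≤ n + 6 := by positivity
  have c1 := mul_le_mul_of_nonneg_left hEr hn
  have c2 := mul_le_mul_of_nonneg_left (abs_le.1 b1).2 hn
  have c3 := (abs_le.1 b2).1
  have c4 := (abs_le.1 b3).1
  linarith

theorem positivityIndicator_rescaling (v : 𝔼 → ℝ) {s : ℝ} (hs : 0 < s) (x : 𝔼) :
    positivityIndicator (rescaling v 0 s) x = positivityIndicator v (s • x) := by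
  have hx : rescaling v 0 s x = v (s • x) / s ^ 2 := by rw [rescaling, zero_add]
  rcases le_or_gt (v (s • x)) 0 with h | h
  · rw [positivityIndicator_of_nonpos h, positivityIndicator_of_nonpos]
    rw [hx]
    exact div_nonpos_of_nonpos_of_nonneg h (sq_nonneg s)
  · rw [positivityIndicator_of_pos h, positivityIndicator_of_pos]
    rw [hx]
    exact div_pos h (by positivity)

theorem tendsto_mul_nhdsGT_zero {s : ℝ} (hs : 0 < s) :
    Tendsto (fun r : ℝ => r * s) (𝓝[>] 0) (𝓝[>] 0) := by
  refine tendsto_nhdsWithin_iff.2 ⟨?_, ?_⟩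
  · have : Tendsto (fun r : ℝ => r * s) (𝓝 0) (𝓝 (0 * s)) := tendsto_id.mul_const s
    rw [zero_mul] at this
    exact this.mono_left nhdsWithin_le_nhds
  · filter_upwards [self_mem_nhdsWithin] with r hr
    exact mul_pos hr hs

/-- Any test function is dominated by a multiple of a dilated `cutoff`, and dilating only changes
the radius from r to rs, so vanishing density in the unit ball suffices. -/
theorem IsLocalSolution.tendsto_integral_positivityIndicator (h : IsLocalSolution L R v)
    (hR : 0 < R) (hE : EnergyBounded R v) {ζ : 𝔼 → ℝ} (hζ : Continuous ζ)
    (hc : HasCompactSupport ζ) :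
    Tendsto (fun r => ∫ x, positivityIndicator (_root_.rescaling v 0 r) x * ζ x)
      (𝓝[>] 0) (𝓝 (∫ x, ζ x)) := by
  obtain ⟨ρ, hρ0, hρ⟩ : ∃ ρ : ℝ, 0 < ρ ∧ tsupport ζ ⊆ closedBall 0 ρ := by
    obtain ⟨ρ, hρ⟩ := hc.isCompact.isBounded.subset_closedBall (0 : 𝔼)
    exact ⟨max ρ 1, by positivity, hρ.trans (closedBall_subset_closedBall (le_max_left _ _))⟩
  obtain ⟨B, hB0, hB⟩ := exists_forall_abs_le hζ ρ
  set s := 2 * ρ with hs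
  have hs0 : 0 < s := by positivity
  -- With s = 2ρ the support lands in |x| ≤ 1/2, where φ ≥ 9/16 ≥ 1/2.
  have hζle : ∀ x, |ζ x| ≤ 2 * B * cutoff (s⁻¹ • x) := fun x => by
    by_cases hx : x ∈ tsupport ζ
    · have hx' : ‖x‖ ≤ ρ := by simpa using hρ hx
      have h1 : ‖s⁻¹ • x‖ ≤ 1 / 2 := by
        rw [norm_smul, norm_inv, Real.norm_of_nonneg hs0.le, inv_mul_le_iff₀ hs0, hs]
        linarith
      have h2 : 1 / 2 ≤ cutoff (s⁻¹ • x) := by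
        unfold cutoff
        have h3 : ‖s⁻¹ • x‖ ^ 2 ≤ (1 / 2) ^ 2 := by gcongr
        have h4 : 3 / 4 ≤ max 0 (1 - ‖s⁻¹ • x‖ ^ 2) := le_max_of_le_right (by linarith)
        nlinarith
      have h5 := hB x hx'
      nlinarith
    · rw [image_eq_zero_of_notMem_tsupport hx, abs_zero]
      exact mul_nonneg (by positivity) (cutoff_nonneg _)
  have hlim := ((h.tendsto_zero_set hR hE).comp (tendsto_mul_nhdsGT_zero hs0)).const_mul
    (2 * B * |(s ^ n)|)
  rw [mul_zero] at hlim
  rw [tendsto_iff_dist_tendsto_zero]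
  refine squeeze_zero' (Eventually.of_forall fun _ => dist_nonneg) ?_ hlim
  filter_upwards [self_mem_nhdsWithin] with r hr
  have hsol := h.rescaling (mem_Ioi.1 hr)
  have hvc := hsol.contDiff.continuous
  have hζi : Integrable ζ := hζ.integrable_of_hasCompactSupport hc
  have hci : Integrable fun x : 𝔼 => cutoff (s⁻¹ • x) :=
    integrable_cutoff.comp_smul (inv_ne_zero hs0.ne')
  simp only [Function.comp_apply]
  rw [rescaling_mul]
  set w := _root_.rescaling v 0 r
  have hchg : ∫ x, (1 - positivityIndicator (_root_.rescaling w 0 s) x) * cutoff x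
      = |(s ^ n)⁻¹| * ∫ x, (1 - positivityIndicator w x) * cutoff (s⁻¹ • x) := by
    have := Measure.integral_comp_smul volume
      (fun x => (1 - positivityIndicator w x) * cutoff (s⁻¹ • x)) s
    simp only [smul_smul, inv_mul_cancel₀ hs0.ne', one_smul, smul_eq_mul,
      finrank_euclideanSpace_fin] at this
    rw [← this]
    simp_rw [positivityIndicator_rescaling w hs0]
  have hcancel : 2 * B * |s ^ n| * (|(s ^ n)⁻¹| *
      ∫ x, (1 - positivityIndicator w x) * cutoff (s⁻¹ • x))
      = 2 * B * ∫ x, (1 - positivityIndicator w x) * cutoff (s⁻¹ • x) := by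
    rw [abs_inv]
    have : |s ^ n| ≠ 0 := by positivity
    field_simp
  rw [hchg, hcancel, dist_comm, dist_eq_norm,
    ← integral_sub hζi (integrable_positivityIndicator_mul hvc hζi), ← integral_const_mul]
  refine norm_integral_le_of_norm_le ?_ (Eventually.of_forall fun x => ?_)
  · refine ((hci.sub (integrable_positivityIndicator_mul hvc hci)).congr
      (Eventually.of_forall fun x => ?_)).const_mul _
    simp only [Pi.sub_apply]
    ring
  · have h1 : 0 ≤ 1 - positivityIndicator w x := sub_nonneg.2 (positivityIndicator_le_one w x)
    have h2 : ζ x - positivityIndicator w x * ζ x = (1 - positivityIndicator w x) * ζ x := by ring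
    rw [h2, norm_mul, Real.norm_of_nonneg h1, Real.norm_eq_abs]
    nlinarith [mul_le_mul_of_nonneg_left (hζle x) h1]

/-- Blow-ups along ultrafilters are quadratic polynomials. -/
theorem IsLocalSolution.exists_tendsto_ultrafilter (h : IsLocalSolution L R v)
    (hR : 0 < R) (hE : EnergyBounded R v) (𝒰 : Ultrafilter ℝ) (h𝒰 : ↑𝒰 ≤ 𝓝[>] (0 : ℝ)) :
    ∃ A : Matrix (Fin n) (Fin n) ℝ, A.PosSemidef ∧ A.trace = 1 ∧
      ∀ x, Tendsto (fun r => _root_.rescaling v 0 r x) 𝒰 (𝓝 (quadraticPoly A x)) := by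
  have hw : ∀ᶠ r in 𝒰, IsC11Zero L (_root_.rescaling v 0 r) := by
    filter_upwards [h𝒰 self_mem_nhdsWithin] with r hr
    exact h.toIsC11Zero.rescaling hr
  obtain ⟨q, hq, hlim, -⟩ := exists_tendsto_of_ultrafilter 𝒰 hw
  have hq0 : ∀ x, 0 ≤ q x := fun x =>
    ge_of_tendsto' (hlim x) fun r => rescaling_nonneg h.nonneg 0 r x
  suffices hweak : WeakLaplacianOn univ q fun _ => 1 by
    obtain ⟨A, hA, htr, rfl⟩ := hq.mem_blowupPolynomials hq0 hweak
    exact ⟨A, hA, htr, hlim⟩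
  intro ζ hζ hc _
  have hgc := continuous_gradient hζ
  obtain ⟨ρ, hρ0, hρ⟩ : ∃ ρ : ℝ, 0 < ρ ∧ tsupport ζ ⊆ ball 0 ρ := by
    obtain ⟨ρ, hρ⟩ := hc.isCompact.isBounded.subset_ball (0 : 𝔼)
    exact ⟨max ρ 1, by positivity, hρ.trans (ball_subset_ball (le_max_left _ _))⟩
  have hgz : ∀ x ∉ tsupport ζ, ∇ ζ x = 0 := fun x hx => by
    rw [gradient, fderiv_of_notMem_tsupport ℝ hx, map_zero]
  obtain ⟨B, hB⟩ := hc.isCompact.exists_bound_of_continuousOn hgc.continuousOn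
  have l1 : Tendsto (fun r => ∫ x, inner ℝ (∇ (_root_.rescaling v 0 r) x) (∇ ζ x)) 𝒰
      (𝓝 (∫ x, inner ℝ (∇ q x) (∇ ζ x))) := by
    refine tendsto_integral_of_forall_abs_sub_le hc.isCompact (hw.mono fun r hr =>
      (continuous_gradient hr.contDiff).inner hgc) ((continuous_gradient hq.contDiff).inner hgc)
      (fun r x hx => by rw [hgz x hx, inner_zero_right])
      (fun x hx => by rw [hgz x hx, inner_zero_right]) fun ε hε => ?_
    filter_upwards [eventually_norm_gradient_sub_le hw hq.contDiff hlim hc.isCompact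
      (show 0 < ε / (|B| + 1) by positivity)] with r hr x hx
    rw [← inner_sub_left]
    calc _ ≤ ‖∇ (_root_.rescaling v 0 r) x - ∇ q x‖ * ‖∇ ζ x‖ := abs_real_inner_le_norm _ _
      _ ≤ ε / (|B| + 1) * (|B| + 1) := by
          gcongr
          · exact hr x hx
          · linarith [hB x hx, le_abs_self B]
      _ = ε := by field_simp
  have l2 := ((h.tendsto_integral_positivityIndicator hR hE hζ.continuous hc).mono_left h𝒰).neg
  simp only [one_mul]
  refine tendsto_nhds_unique (l1.congr' ?_) l2
  filter_upwards [h𝒰 (Ioo_mem_nhdsGT (show 0 < R / ρ by positivity))] with r hr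
  refine (h.rescaling hr.1).weakLaplacianOn ζ hζ hc (hρ.trans (ball_subset_ball ?_))
  rw [le_div_iff₀ hr.1, mul_comm]
  exact ((lt_div_iff₀ hρ0).1 hr.2).le

/-- The integral sees only the unit ball; homogeneity of the polynomial and the change of radius r ↦
rs carry the convergence to all x. -/
theorem IsLocalSolution.tendsto_rescaling_of_tendsto_integral (h : IsLocalSolution L R v)
    {A : Matrix (Fin n) (Fin n) ℝ} (hA : A.IsHermitian)
    (hlim : Tendsto (fun r => ∫ x, weight x * (_root_.rescaling v 0 r x - quadraticPoly A x) ^ 2)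
      (𝓝[>] 0) (𝓝 0)) (x : 𝔼) :
    Tendsto (fun r => _root_.rescaling v 0 r x) (𝓝[>] 0) (𝓝 (quadraticPoly A x)) := by
  have hw : ∀ᶠ r in 𝓝[>] (0 : ℝ), IsC11Zero L (_root_.rescaling v 0 r) := by
    filter_upwards [self_mem_nhdsWithin] with r hr
    exact h.toIsC11Zero.rescaling hr
  set s := 1 + ‖x‖
  have hs : 0 < s := by positivity
  have hx : ‖s⁻¹ • x‖ < 1 := by
    rw [norm_smul, norm_inv, Real.norm_of_nonneg hs.le, inv_mul_lt_iff₀ hs]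
    simp only [s]; linarith
  have h1 := ((tendsto_of_tendsto_integral_weight_mul_sq hw (contDiff_quadraticPoly hA).continuous
    hlim hx).comp (tendsto_mul_nhdsGT_zero hs)).const_mul (s ^ 2)
  rw [quadraticPoly_smul, ← mul_assoc, ← mul_pow, mul_inv_cancel₀ hs.ne', one_pow, one_mul] at h1
  refine h1.congr fun r => ?_
  rw [Function.comp_apply, rescaling_mul]
  simp only [_root_.rescaling, zero_add, smul_smul, mul_inv_cancel₀ hs.ne', mul_one]
  field_simp

/-- Uniqueness of the blow-up. -/
theorem IsLocalSolution.exists_tendsto_rescaling (h : IsLocalSolution L R v)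
    (hR : 0 < R) (hE : EnergyBounded R v) :
    ∃ A : Matrix (Fin n) (Fin n) ℝ, A.PosSemidef ∧ A.trace = 1 ∧
      ∀ x, Tendsto (fun r => _root_.rescaling v 0 r x) (𝓝[>] 0) (𝓝 (quadraticPoly A x)) := by
  have h𝒰 : ↑(Ultrafilter.of (𝓝[>] (0 : ℝ))) ≤ 𝓝[>] (0 : ℝ) := Ultrafilter.of_le _
  obtain ⟨A, hA, htr, hlim⟩ := h.exists_tendsto_ultrafilter hR hE _ h𝒰
  refine ⟨A, hA, htr, h.tendsto_rescaling_of_tendsto_integral hA.isHermitian ?_⟩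
  have hpc := (contDiff_quadraticPoly hA.isHermitian).continuous
  have hw : ∀ᶠ r in Ultrafilter.of (𝓝[>] (0 : ℝ)), IsC11Zero L (_root_.rescaling v 0 r) := by
    filter_upwards [h𝒰 self_mem_nhdsWithin] with r hr
    exact h.toIsC11Zero.rescaling hr
  have hl := tendsto_integral_weight_mul_sq hw hpc hpc hlim
  simp only [sub_self, ne_eq, OfNat.ofNat_ne_zero, not_false_eq_true, zero_pow, mul_zero,
    integral_zero] at hl
  rw [Metric.tendsto_nhds]
  intro ε hε
  -- One radius with a small Monneau integral is enough: monotonicity controls all smaller ones.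
  obtain ⟨r₀, hr₀, hr₀ε⟩ := ((hl.eventually (gt_mem_nhds hε)).and
    (h𝒰 (Ioo_mem_nhdsGT hR))).exists
  filter_upwards [Ioo_mem_nhdsGT hr₀ε.1] with r hr
  rw [Real.dist_eq, sub_zero, abs_of_nonneg (integral_nonneg fun x =>
    mul_nonneg (weight_nonneg x) (sq_nonneg _))]
  exact (h.monneau_mono hE hA htr hr.1 hr.2.le hr₀ε.2).trans_lt hr₀

/-- A blow-up sequence converging to a polynomial in `blowupPolynomials n` bounds the energy. -/
theorem IsLocalSolution.energyBounded (h : IsLocalSolution L R v)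
    {A : Matrix (Fin n) (Fin n) ℝ} (hA : A.PosSemidef) (htr : A.trace = 1) {r : ℕ → ℝ}
    (hr : ∀ k, 0 < r k) (hr0 : Tendsto r atTop (𝓝 0))
    (hlim : ∀ x, Tendsto (fun k => _root_.rescaling v 0 (r k) x) atTop
      (𝓝 (quadraticPoly A x))) : EnergyBounded R v := by
  have hw : ∀ k, IsC11Zero L (_root_.rescaling v 0 (r k)) := fun k =>
    h.toIsC11Zero.rescaling (hr k)
  have h𝒰 : ↑(Ultrafilter.of (atTop : Filter ℕ)) ≤ (atTop : Filter ℕ) := Ultrafilter.of_le _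
  -- The ultrafilter serves only to place the polynomial in the class `IsC11Zero L`, as continuity
  -- of the energy requires.
  obtain ⟨q, hq, hql, -⟩ := exists_tendsto_of_ultrafilter (Ultrafilter.of atTop)
    (Eventually.of_forall hw)
  obtain rfl : q = quadraticPoly A :=
    funext fun x => tendsto_nhds_unique (hql x) ((hlim x).mono_left h𝒰)
  have hen := tendsto_energy (Eventually.of_forall hw) hq hlim
  rw [energy_quadraticPoly hA.isHermitian htr] at hen
  intro s hs hsR
  refine le_of_tendsto hen ?_
  filter_upwards [hr0.eventually (gt_mem_nhds hs)] with k hk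
  exact h.energy_mono (hr k) hk.le hsR

end BlowUp

/-! ### Localization: global C^{1,1} extensions of a solution -/

section Extension

theorem norm_smul_sub_smul_le {E F : Type*} [NormedAddCommGroup E] [NormedAddCommGroup F]
    [NormedSpace ℝ F] {a : E → ℝ} {b : E → F} {s : Set E} {A B C D : ℝ}
    (ha : ∀ x ∈ s, ‖a x‖ ≤ A) (hb : ∀ x ∈ s, ‖b x‖ ≤ B)
    (hla : ∀ x ∈ s, ∀ y ∈ s, ‖a x - a y‖ ≤ C * ‖x - y‖)
    (hlb : ∀ x ∈ s, ∀ y ∈ s, ‖b x - b y‖ ≤ D * ‖x - y‖) :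
    ∀ x ∈ s, ∀ y ∈ s, ‖a x • b x - a y • b y‖ ≤ (A * D + C * B) * ‖x - y‖ := by
  intro x hx y hy
  have h1 : a x • b x - a y • b y = a x • (b x - b y) + (a x - a y) • b y := by module
  rw [h1]
  refine (norm_add_le _ _).trans ?_
  rw [norm_smul, norm_smul]
  have hA : 0 ≤ A := (norm_nonneg _).trans (ha x hx)
  have hC : 0 ≤ C * ‖x - y‖ := (norm_nonneg _).trans (hla x hx y hy)
  calc _ ≤ A * (D * ‖x - y‖) + C * ‖x - y‖ * B :=
        add_le_add (mul_le_mul (ha x hx) (hlb x hx y hy) (norm_nonneg _) hA)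
          (mul_le_mul (hla x hx y hy) (hb y hy) (norm_nonneg _) hC)
    _ = _ := by ring

/-- A function vanishing outside a ball and Lipschitz on a larger one is Lipschitz. -/
theorem exists_lipschitzWith_of_ball {E F : Type*} [NormedAddCommGroup E] [NormedAddCommGroup F]
    {f : E → F} {x₀ : E} {r R C : ℝ} (hr : 0 < r) (hrR : r < R)
    (hz : ∀ x ∉ ball x₀ r, f x = 0)
    (hC : ∀ x ∈ ball x₀ R, ∀ y ∈ ball x₀ R, ‖f x - f y‖ ≤ C * ‖x - y‖) :
    ∃ K : NNReal, LipschitzWith K f := by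
  set M := ‖f x₀‖ + |C| * R
  have hR : 0 < R := hr.trans hrR
  have hM0 : 0 ≤ M := by positivity
  have hM : ∀ x ∈ ball x₀ R, ‖f x‖ ≤ M := fun x hx => by
    have h1 := hC x hx x₀ (mem_ball_self hR)
    have h2 : ‖x - x₀‖ ≤ R := by rw [← dist_eq_norm]; exact (mem_ball.1 hx).le
    have h3 : C * ‖x - x₀‖ ≤ |C| * R := by
      calc C * ‖x - x₀‖ ≤ |C| * ‖x - x₀‖ := by gcongr; exact le_abs_self C
        _ ≤ |C| * R := by gcongr
    have h4 := norm_le_insert' (f x) (f x₀)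
    simp only [M]
    linarith
  have hd : 0 < R - r := sub_pos.2 hrR
  set K := max |C| (M / (R - r))
  have hfar : ∀ x ∈ ball x₀ r, ∀ y ∉ ball x₀ R, ‖f x - f y‖ ≤ K * ‖x - y‖ := fun x hx y hy => by
    rw [hz y fun h => hy (ball_subset_ball hrR.le h), sub_zero]
    have h1 : R - r ≤ ‖x - y‖ := by
      rw [mem_ball, not_lt] at hy
      rw [mem_ball] at hx
      have := dist_triangle y x x₀
      rw [dist_comm y x] at this
      rw [← dist_eq_norm]
      linarith
    calc ‖f x‖ ≤ M := hM x (ball_subset_ball hrR.le hx)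
      _ = M / (R - r) * (R - r) := by field_simp
      _ ≤ K * ‖x - y‖ := by
          gcongr
          exact le_max_right _ _
  refine ⟨K.toNNReal, LipschitzWith.of_dist_le' fun x y => ?_⟩
  rw [dist_eq_norm, dist_eq_norm]
  have hK : 0 ≤ K := (abs_nonneg C).trans (le_max_left _ _)
  by_cases hx : x ∈ ball x₀ R
  · by_cases hy : y ∈ ball x₀ R
    · refine (hC x hx y hy).trans ?_
      gcongr
      exact (le_abs_self C).trans (le_max_left _ _)
    · by_cases hx' : x ∈ ball x₀ r
      · exact hfar x hx' y hy
      · rw [hz x hx', hz y fun h => hy (ball_subset_ball hrR.le h), sub_zero, norm_zero]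
        positivity
  · by_cases hy' : y ∈ ball x₀ r
    · rw [norm_sub_rev, norm_sub_rev x]
      exact hfar y hy' x hx
    · rw [hz y hy', hz x fun h => hx (ball_subset_ball hrR.le h), sub_zero, norm_zero]
      positivity

/-- `U` is a globally defined `C^{1,1}` function which agrees in `ball x₀ R` with the solution `u`
of the obstacle problem. -/
structure IsLocalExtension (Ω : Set (EuclideanSpace ℝ (Fin n)))
    (u : EuclideanSpace ℝ (Fin n) → ℝ) (x₀ : EuclideanSpace ℝ (Fin n)) (L R : ℝ)
    (U : EuclideanSpace ℝ (Fin n) → ℝ) : Prop where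
  nonneg_const : 0 ≤ L
  radius_pos : 0 < R
  differentiable : Differentiable ℝ U
  norm_gradient_sub_le : ∀ x y, ‖∇ U x - ∇ U y‖ ≤ L * ‖x - y‖
  nonneg : ∀ x, 0 ≤ U x
  ball_subset : ball x₀ R ⊆ Ω
  eqOn : EqOn U u (ball x₀ R)
  weakLaplacianOn : WeakLaplacianOn (ball x₀ R) U (positivityIndicator U)

/-- Multiplication by a bump function equal to 1 near x₀ keeps u nonnegative and gives a globally
Lipschitz derivative; the equation is kept where the bump is 1. -/
theorem exists_isLocalExtension {Ω : Set 𝔼} (hΩ : IsOpen Ω) {u : 𝔼 → ℝ}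
    (hu : IsObstacleSolution Ω u) {x₀ : 𝔼} (hx₀ : x₀ ∈ Ω) :
    ∃ L R U, IsLocalExtension Ω u x₀ L R U := by
  obtain ⟨D, t, ht, hD⟩ := hu.locallyLipschitzOn_fderiv hx₀
  rw [hΩ.nhdsWithin_eq hx₀] at ht
  obtain ⟨R, hR, hRt⟩ := Metric.mem_nhds_iff.1 (inter_mem ht (hΩ.mem_nhds hx₀))
  have hBt : ball x₀ R ⊆ t := hRt.trans inter_subset_left
  have hBΩ : ball x₀ R ⊆ Ω := hRt.trans inter_subset_right
  have hdiff : ∀ x ∈ ball x₀ R, DifferentiableAt ℝ u x := fun x hx =>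
    hu.differentiableOn.differentiableAt (hΩ.mem_nhds (hBΩ hx))
  have hnorm : ∀ x ∈ ball x₀ R, ‖x - x₀‖ ≤ R := fun x hx => by
    rw [← dist_eq_norm]; exact (mem_ball.1 hx).le
  have hlD : ∀ x ∈ ball x₀ R, ∀ y ∈ ball x₀ R, ‖fderiv ℝ u x - fderiv ℝ u y‖ ≤ D * ‖x - y‖ :=
    fun x hx y hy => hD.norm_sub_le (hBt hx) (hBt hy)
  set B := ‖fderiv ℝ u x₀‖ + D * R
  have hB : ∀ x ∈ ball x₀ R, ‖fderiv ℝ u x‖ ≤ B := fun x hx => by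
    have h1 := hlD x hx x₀ (mem_ball_self hR)
    have h2 : D * ‖x - x₀‖ ≤ D * R := by gcongr; exact hnorm x hx
    have h3 := norm_le_insert' (fderiv ℝ u x) (fderiv ℝ u x₀)
    simp only [B]
    linarith
  have hlu : ∀ x ∈ ball x₀ R, ∀ y ∈ ball x₀ R, ‖u x - u y‖ ≤ B * ‖x - y‖ := fun x hx y hy =>
    (convex_ball x₀ R).norm_image_sub_le_of_norm_fderiv_le hdiff hB hy hx
  have hA : ∀ x ∈ ball x₀ R, ‖u x‖ ≤ ‖u x₀‖ + B * R := fun x hx => by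
    have h1 := hlu x hx x₀ (mem_ball_self hR)
    have h2 : B * ‖x - x₀‖ ≤ B * R := by gcongr; exact hnorm x hx
    have h3 := norm_le_insert' (u x) (u x₀)
    linarith
  let η : ContDiffBump x₀ := ⟨R / 3, R / 2, by positivity, by linarith⟩
  have hη : ContDiff ℝ 2 η := η.contDiff
  have hη1 : ContDiff ℝ 1 (fderiv ℝ η) := hη.fderiv_right (by norm_num)
  have hηd : Differentiable ℝ η := hη.differentiable two_ne_zero
  have hcs : HasCompactSupport η := η.hasCompactSupport
  obtain ⟨K₀, hK₀⟩ := ContDiff.lipschitzWith_of_hasCompactSupport hcs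
    (hη.of_le one_le_two) one_ne_zero
  obtain ⟨K₁, hK₁⟩ := ContDiff.lipschitzWith_of_hasCompactSupport (hcs.fderiv ℝ) hη1 one_ne_zero
  have hη0 : ∀ x ∉ ball x₀ (R / 2), η x = 0 := fun x hx => by
    rw [← Function.notMem_support, η.support_eq]; exact hx
  set U : 𝔼 → ℝ := fun x => η x * u x
  have hUz : ∀ x ∉ closedBall x₀ (R / 2), U =ᶠ[𝓝 x] fun _ => 0 := fun x hx => by
    filter_upwards [isClosed_closedBall.isOpen_compl.mem_nhds hx] with y hy
    simp only [U]
    rw [hη0 y fun h => hy (ball_subset_closedBall h), zero_mul]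
  have hUd : ∀ x ∈ ball x₀ R, HasFDerivAt U (η x • fderiv ℝ u x + u x • fderiv ℝ η x) x :=
    fun x hx => (hηd x).hasFDerivAt.mul (hdiff x hx).hasFDerivAt
  have hUdiff : Differentiable ℝ U := fun x => by
    by_cases hx : x ∈ ball x₀ R
    · exact (hUd x hx).differentiableAt
    · refine (differentiableAt_const (0 : ℝ)).congr_of_eventuallyEq (hUz x fun h => hx ?_)
      exact closedBall_subset_ball (by linarith) h
  have hUlip : ∃ K : NNReal, LipschitzWith K (fderiv ℝ U) := by
    have e1 := norm_smul_sub_smul_le (s := ball x₀ R) (a := η) (b := fderiv ℝ u) (A := 1)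
      (fun x _ => by rw [Real.norm_of_nonneg η.nonneg]; exact η.le_one) hB
      (fun x _ y _ => hK₀.norm_sub_le x y) hlD
    have e2 := norm_smul_sub_smul_le (s := ball x₀ R) (a := u) (b := fderiv ℝ η) hA
      (fun x _ => norm_fderiv_le_of_lipschitz ℝ hK₀) hlu (fun x _ y _ => hK₁.norm_sub_le x y)
    -- Any radius strictly between R/2 and R would do: U vanishes near each point outside the closed
    -- ball of radius R/2.
    refine exists_lipschitzWith_of_ball (r := 2 * R / 3) (R := R) (x₀ := x₀)
      (C := (1 * D + K₀ * B) + ((‖u x₀‖ + B * R) * K₁ + B * K₀)) (by positivity) (by linarith)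
      (fun x hx => ?_) fun x hx y hy => ?_
    · rw [(hUz x fun h => hx (closedBall_subset_ball (by linarith) h)).fderiv_eq]
      simp
    · rw [(hUd x hx).fderiv, (hUd y hy).fderiv, add_sub_add_comm, add_mul]
      exact (norm_add_le _ _).trans (add_le_add (e1 x hx y hy) (e2 x hx y hy))
  obtain ⟨K, hK⟩ := hUlip
  have hEq : EqOn U u (ball x₀ (R / 3)) := fun x hx => by
    simp only [U]
    rw [η.one_of_mem_closedBall (ball_subset_closedBall hx), one_mul]
  refine ⟨K, R / 3, U, K.2, by positivity, hUdiff, fun x y => ?_, fun x => ?_,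
    (ball_subset_ball (by linarith)).trans hBΩ, hEq, ?_⟩
  · rw [norm_gradient_sub_gradient]
    exact hK.norm_sub_le x y
  · by_cases hx : x ∈ ball x₀ R
    · exact mul_nonneg η.nonneg (hu.nonneg x (hBΩ hx))
    · simp only [U]
      rw [hη0 x fun h => hx (ball_subset_ball (by linarith) h), zero_mul]
  · refine weakLaplacianOn_of_ae hK ?_
    filter_upwards [hu.laplacian_eq] with x hx hxB
    have hloc : U =ᶠ[𝓝 x] u := by
      filter_upwards [isOpen_ball.mem_nhds hxB] with y hy using hEq hy
    rw [(InnerProductSpace.laplacian_congr_nhds hloc).eq_of_nhds,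
      hx (hBΩ (ball_subset_ball (by linarith) hxB))]
    simp only [positivityIndicator, indicator, mem_ofPred_eq, hEq hxB]

variable {Ω : Set (EuclideanSpace ℝ (Fin n))} {u U : EuclideanSpace ℝ (Fin n) → ℝ}
  {x₀ x : EuclideanSpace ℝ (Fin n)} {L R : ℝ}

theorem IsLocalExtension.apply_eq_zero (h : IsLocalExtension Ω u x₀ L R U) (hx : x ∈ ball x₀ R)
    (hf : x ∈ freeBoundary Ω u) : U x = 0 := by
  by_contra hne
  have hpos : 0 < U x := (h.nonneg x).lt_of_ne' hne
  have hmem : {x | x ∈ Ω ∧ 0 < u x} ∈ 𝓝 x := by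
    filter_upwards [isOpen_ball.mem_nhds hx,
      (h.differentiable x).continuousAt.eventually (lt_mem_nhds hpos)] with y hy hy'
    exact ⟨h.ball_subset hy, (h.eqOn hy) ▸ hy'⟩
  exact hf.2.2 (mem_interior_iff_mem_nhds.2 hmem)

theorem IsLocalExtension.gradient_eq_zero (h : IsLocalExtension Ω u x₀ L R U) (h0 : U x = 0) :
    ∇ U x = 0 := by
  have : IsLocalMin U x := Eventually.of_forall fun y => h0 ▸ h.nonneg y
  rw [gradient, this.fderiv_eq_zero, map_zero]

/-- Rescaling with radius 1 is translation of x to the origin. Halving R makes the ball around x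
fit, with L and the radius uniform for x near x₀. -/
theorem IsLocalExtension.isLocalSolution (h : IsLocalExtension Ω u x₀ L R U)
    (hx : x ∈ ball x₀ (R / 2)) (hf : x ∈ freeBoundary Ω u) :
    IsLocalSolution L (R / 2) (rescaling U x 1) := by
  have hR := h.radius_pos
  have h0 := h.apply_eq_zero (ball_subset_ball (by linarith) hx) hf
  refine ⟨isC11Zero_rescaling h.nonneg_const h.differentiable h.norm_gradient_sub_le h0
    (h.gradient_eq_zero h0) one_pos, rescaling_nonneg h.nonneg x 1, ?_⟩
  have := weakLaplacianOn_rescaling h.differentiable (x₀ := x) (R := R / 2)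
    (h.weakLaplacianOn.mono (ball_subset_ball' (by linarith [mem_ball.1 hx]))) one_pos
  rwa [div_one] at this

theorem IsLocalExtension.eventually_rescaling_eq (h : IsLocalExtension Ω u x₀ L R U)
    (hx : x ∈ ball x₀ R) (z : 𝔼) :
    ∀ᶠ r in 𝓝 (0 : ℝ), ∀ y ∈ ball z 1, rescaling U x r y = rescaling u x r y := by
  obtain ⟨δ, hδ, hball⟩ := Metric.isOpen_ball.mem_nhds hx |> Metric.mem_nhds_iff.1
  have hpos : 0 < δ / (‖z‖ + 1) := by positivity
  filter_upwards [ball_mem_nhds (0 : ℝ) hpos] with r hr y hy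
  have hmem : x + r • y ∈ ball x₀ R := by
    refine hball ?_
    rw [mem_ball, dist_eq_norm, add_sub_cancel_left, norm_smul]
    have hr' : ‖r‖ < δ / (‖z‖ + 1) := by simpa using hr
    have hy' : ‖y‖ ≤ ‖z‖ + 1 := by
      have := norm_le_insert' y z
      have h2 : ‖y - z‖ < 1 := by rw [← dist_eq_norm]; exact hy
      linarith
    calc ‖r‖ * ‖y‖ ≤ ‖r‖ * (‖z‖ + 1) := by gcongr
      _ < δ / (‖z‖ + 1) * (‖z‖ + 1) := by gcongr
      _ = δ := by field_simp
  rw [rescaling, rescaling, h.eqOn hmem]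

theorem IsLocalExtension.energyBounded (h : IsLocalExtension Ω u x₀ L R U)
    (hx : x ∈ ball x₀ (R / 2)) (hs : x ∈ singularSet Ω u) :
    EnergyBounded (R / 2) (rescaling U x 1) := by
  obtain ⟨hf, _, ⟨A, hA, htr, rfl⟩, r, hr, hr0, hlim⟩ := hs
  have hR := h.radius_pos
  refine (h.isLocalSolution hx hf).energyBounded hA htr hr hr0 fun y => ?_
  refine (hlim y).congr' ?_
  filter_upwards [hr0.eventually (h.eventually_rescaling_eq
    (ball_subset_ball (by linarith) hx) y)] with k hk
  rw [← rescaling_mul, one_mul, hk y (mem_ball_self one_pos)]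

/-- At a free boundary point with the energy bound the solution has a unique blow-up. -/
theorem IsLocalExtension.exists_tendsto (h : IsLocalExtension Ω u x₀ L R U)
    (hx : x ∈ ball x₀ (R / 2)) (hf : x ∈ freeBoundary Ω u)
    (hE : EnergyBounded (R / 2) (rescaling U x 1)) :
    ∃ A : Matrix (Fin n) (Fin n) ℝ, A.PosSemidef ∧ A.trace = 1 ∧
      ∀ y, Tendsto (fun r => rescaling U x r y) (𝓝[>] 0) (𝓝 (quadraticPoly A y)) := by
  obtain ⟨A, hA, htr, hlim⟩ := (h.isLocalSolution hx hf).exists_tendsto_rescaling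
    (half_pos h.radius_pos) hE
  refine ⟨A, hA, htr, fun y => (hlim y).congr fun r => ?_⟩
  rw [← rescaling_mul, one_mul]

theorem tendstoLocallyUniformly_congr_of_eventually {ι X Y : Type*} [TopologicalSpace X]
    [UniformSpace Y] {l : Filter ι} {F G : ι → X → Y} {f : X → Y}
    (h : TendstoLocallyUniformly F f l)
    (hFG : ∀ x, ∃ t ∈ 𝓝 x, ∀ᶠ i in l, ∀ y ∈ t, F i y = G i y) :
    TendstoLocallyUniformly G f l := by
  intro v hv x
  obtain ⟨t, ht, h1⟩ := h v hv x
  obtain ⟨s, hs, h2⟩ := hFG x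
  refine ⟨t ∩ s, inter_mem ht hs, ?_⟩
  filter_upwards [h1, h2] with i hi1 hi2 y hy
  rw [← hi2 y hy.2]
  exact hi1 y hy.1

theorem exists_blowup (hΩ : IsOpen Ω) (hu : IsObstacleSolution Ω u) (hx : x ∈ singularSet Ω u) :
    ∃ A : Matrix (Fin n) (Fin n) ℝ, A.PosSemidef ∧ A.trace = 1 ∧
      TendstoLocallyUniformly (fun r : ℝ => rescaling u x r) (quadraticPoly A) (𝓝[>] 0) ∧
      TendstoLocallyUniformly (fun r : ℝ => fderiv ℝ (rescaling u x r))
        (fderiv ℝ (quadraticPoly A)) (𝓝[>] 0) := by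
  obtain ⟨L, R, U, h⟩ := exists_isLocalExtension hΩ hu hx.1.1
  have hxR : x ∈ ball x (R / 2) := mem_ball_self (half_pos h.radius_pos)
  have hsol := h.isLocalSolution hxR hx.1
  obtain ⟨A, hA, htr, hlim⟩ := h.exists_tendsto hxR hx.1 (h.energyBounded hxR hx)
  have hw : ∀ᶠ r in 𝓝[>] (0 : ℝ), IsC11Zero L (rescaling U x r) := by
    filter_upwards [self_mem_nhdsWithin] with r hr
    have := hsol.toIsC11Zero.rescaling hr
    rwa [← rescaling_mul, one_mul] at this
  have hp := contDiff_quadraticPoly hA.isHermitian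
  have heq : ∀ z : 𝔼, ∀ᶠ r in 𝓝[>] (0 : ℝ), ∀ y ∈ ball z 1, rescaling U x r y = rescaling u x r y :=
    fun z => nhdsWithin_le_nhds (h.eventually_rescaling_eq (mem_ball_self h.radius_pos) z)
  refine ⟨A, hA, htr, ?_, ?_⟩
  · exact tendstoLocallyUniformly_congr_of_eventually
      (tendstoLocallyUniformly_of_isC11Zero hw hp.continuous hlim)
      fun z => ⟨ball z 1, ball_mem_nhds z one_pos, heq z⟩
  · refine tendstoLocallyUniformly_congr_of_eventually
      (tendstoLocallyUniformly_fderiv hw hp hlim)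
      fun z => ⟨ball z 1, ball_mem_nhds z one_pos, (heq z).mono fun r hr y hy => ?_⟩
    refine Filter.EventuallyEq.fderiv_eq ?_
    filter_upwards [isOpen_ball.mem_nhds hy] with y' hy' using hr y' hy'

end Extension

/-! ### Continuity of the blow-up map -/

section Continuity

variable {Ω : Set (EuclideanSpace ℝ (Fin n))} {u U : EuclideanSpace ℝ (Fin n) → ℝ}
  {x₀ : EuclideanSpace ℝ (Fin n)} {L R : ℝ} {ι : Type*}

theorem IsLocalExtension.tendsto_rescaling_center (h : IsLocalExtension Ω u x₀ L R U)
    {l : Filter ι} {z : ι → 𝔼} {x : 𝔼} (hz : Tendsto z l (𝓝 x)) (r : ℝ) (y : 𝔼) :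
    Tendsto (fun i => rescaling U (z i) r y) l (𝓝 (rescaling U x r y)) :=
  ((h.differentiable.continuous.tendsto _).comp (hz.add_const _)).div_const _

/-- If singular points converge to `x₀`, then their blow-ups converge to the blow-up at `x₀`. -/
theorem exists_tendsto_blowup (hΩ : IsOpen Ω) (hu : IsObstacleSolution Ω u) (hx₀ : x₀ ∈ Ω)
    {p : 𝔼 → 𝔼 → ℝ} (hp : ∀ x ∈ singularSet Ω u, p x ∈ blowupPolynomials n ∧
      ∀ y, Tendsto (fun r => rescaling u x r y) (𝓝[>] 0) (𝓝 (p x y))) :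
    ∃ q : 𝔼 → ℝ, ∀ ε > 0, ∀ᶠ x in 𝓝[singularSet Ω u] x₀, ∀ z : 𝔼, ‖z‖ ≤ 1 → |p x z - q z| ≤ ε := by
  set l := 𝓝[singularSet Ω u] x₀
  -- If x₀ is not in the closure of Σ there is nothing to approximate and any q works.
  rcases l.eq_or_neBot with hl | hl
  · exact ⟨0, fun ε _ => by rw [hl]; exact eventually_bot⟩
  obtain ⟨L, R, U, h⟩ := exists_isLocalExtension hΩ hu hx₀
  have hR := h.radius_pos
  have hlx : Tendsto (fun x : 𝔼 => x) l (𝓝 x₀) := tendsto_id.mono_left nhdsWithin_le_nhds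
  have hball : ∀ᶠ x in l, x ∈ ball x₀ (R / 2) := hlx (ball_mem_nhds x₀ (half_pos hR))
  have hsing : ∀ᶠ x in l, x ∈ singularSet Ω u := self_mem_nhdsWithin
  have hx₀b : x₀ ∈ ball x₀ (R / 2) := mem_ball_self (half_pos hR)
  have hx₀f : x₀ ∈ freeBoundary Ω u :=
    ⟨hx₀, isClosed_frontier.mem_of_tendsto hlx (hsing.mono fun x hx => hx.1.2)⟩
  have hC : ∀ r, 0 < r → ∀ x ∈ ball x₀ (R / 2), x ∈ freeBoundary Ω u →
      IsC11Zero L (rescaling U x r) := fun r hr x hx hf => by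
    have := (h.isLocalSolution hx hf).toIsC11Zero.rescaling hr
    rwa [← rescaling_mul, one_mul] at this
  have hCl : ∀ r, 0 < r → ∀ᶠ x in l, IsC11Zero L (rescaling U x r) := fun r hr => by
    filter_upwards [hball, hsing] with x hx hs using hC r hr x hx hs.1
  -- At each fixed radius the energy is continuous in the centre, so x₀ inherits the bound without
  -- being assumed singular.
  have hE : EnergyBounded (R / 2) (rescaling U x₀ 1) := fun r hr hrR => by
    rw [← rescaling_mul, one_mul]
    refine ge_of_tendsto (tendsto_energy (hCl r hr) (hC r hr x₀ hx₀b hx₀f)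
      (h.tendsto_rescaling_center hlx r)) ?_
    filter_upwards [hball, hsing] with x hx hs
    have := h.energyBounded hx hs r hr hrR
    rwa [← rescaling_mul, one_mul] at this
  obtain ⟨A, hA, htr, hlim⟩ := h.exists_tendsto hx₀b hx₀f hE
  have hqc := (contDiff_quadraticPoly hA.isHermitian).continuous
  set q := quadraticPoly A
  have hpU : ∀ x ∈ ball x₀ (R / 2), x ∈ singularSet Ω u →
      ∀ y, Tendsto (fun r => rescaling U x r y) (𝓝[>] 0) (𝓝 (p x y)) := fun x hx hs y => by
    refine ((hp x hs).2 y).congr' ?_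
    filter_upwards [nhdsWithin_le_nhds (h.eventually_rescaling_eq
      (ball_subset_ball (by linarith) hx) y)] with r hr
    exact (hr y (mem_ball_self one_pos)).symm
  -- The blow-ups near x₀ are limits of rescalings with the common constant L; this equicontinuity
  -- later turns mean-square into pointwise convergence.
  have hpC : ∀ᶠ x in l, IsC11Zero L (p x) := by
    filter_upwards [hball, hsing] with x hx hs
    obtain ⟨v, hv, hvl, -⟩ := exists_tendsto_of_ultrafilter (L := L)
      (w := fun r => rescaling U x r) (Ultrafilter.of (𝓝[>] (0 : ℝ)))
      (Ultrafilter.of_le _ (by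
        filter_upwards [self_mem_nhdsWithin] with r hr using hC r hr x hx hs.1))
    have : v = p x := funext fun y => tendsto_nhds_unique (hvl y)
      ((hpU x hx hs y).mono_left (Ultrafilter.of_le _))
    exact this ▸ hv
  have hH₀ : Tendsto (fun r => ∫ x, weight x * (rescaling U x₀ r x - q x) ^ 2) (𝓝[>] 0) (𝓝 0) := by
    have := tendsto_integral_weight_mul_sq (by
      filter_upwards [self_mem_nhdsWithin] with r hr using hC r hr x₀ hx₀b hx₀f) hqc hqc hlim
    simpa using this
  have hHp : Tendsto (fun x => ∫ y, weight y * (p x y - q y) ^ 2) l (𝓝 0) := by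
    rw [Metric.tendsto_nhds]
    intro ε hε
    -- Order of choices: first r from the blow-up at x₀, then x near x₀ at that r, and finally
    -- Monneau's formula at x, with the polynomial q, down to radius 0.
    obtain ⟨r, hr, hrR⟩ := ((hH₀.eventually (gt_mem_nhds hε)).and
      (Ioo_mem_nhdsGT (half_pos hR))).exists
    have hcen := tendsto_integral_weight_mul_sq (hCl r hrR.1)
      (hC r hrR.1 x₀ hx₀b hx₀f).contDiff.continuous hqc (h.tendsto_rescaling_center hlx r)
    filter_upwards [hcen.eventually (gt_mem_nhds hr), hball, hsing] with x hxε hx hs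
    rw [Real.dist_eq, sub_zero, abs_of_nonneg (integral_nonneg fun x =>
      mul_nonneg (weight_nonneg x) (sq_nonneg _))]
    refine lt_of_le_of_lt ?_ hxε
    obtain ⟨A', hA', -, hpA'⟩ := (hp x hs).1
    have hl0 := tendsto_integral_weight_mul_sq (L := L) (w := fun r => rescaling U x r)
      (l := 𝓝[>] (0 : ℝ)) (by
        filter_upwards [self_mem_nhdsWithin] with r hr using hC r hr x hx hs.1)
      (hpA' ▸ (contDiff_quadraticPoly hA'.isHermitian).continuous) hqc (hpU x hx hs)
    refine le_of_tendsto hl0 ?_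
    filter_upwards [Ioo_mem_nhdsGT hrR.1] with s hs'
    have := (h.isLocalSolution hx hs.1).monneau_mono (h.energyBounded hx hs) hA htr hs'.1 hs'.2.le
      hrR.2
    rwa [← rescaling_mul, ← rescaling_mul, one_mul, one_mul] at this
  refine ⟨q, fun ε hε => ?_⟩
  -- Mean-square convergence settles only |y| < 1; homogeneity of degree two gives the rest,
  -- including the unit sphere.
  have hpt : ∀ y, Tendsto (fun x => p x y) l (𝓝 (q y)) := fun y => by
    set s := 1 + ‖y‖
    have hs : 0 < s := by positivity
    have hy : ‖s⁻¹ • y‖ < 1 := by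
      rw [norm_smul, norm_inv, Real.norm_of_nonneg hs.le, inv_mul_lt_iff₀ hs]
      simp only [s]; linarith
    have hhom : ∀ B : Matrix (Fin n) (Fin n) ℝ,
        quadraticPoly B y = s ^ 2 * quadraticPoly B (s⁻¹ • y) := fun B => by
      rw [quadraticPoly_smul, ← mul_assoc, ← mul_pow, mul_inv_cancel₀ hs.ne', one_pow, one_mul]
    rw [show q y = s ^ 2 * q (s⁻¹ • y) from hhom A]
    refine ((tendsto_of_tendsto_integral_weight_mul_sq hpC hqc hHp hy).const_mul (s ^ 2)).congr' ?_
    filter_upwards [hsing] with x hs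
    obtain ⟨A', -, -, hpA'⟩ := (hp x hs).1
    rw [hpA', ← hhom]
  filter_upwards [eventually_abs_sub_le (tendstoLocallyUniformly_of_isC11Zero hpC hqc hpt)
    (isCompact_closedBall (0 : 𝔼) 1) hε] with x hx z hz
  exact hx z (by simpa using hz)

end Continuity

end ObstacleProblem

open ObstacleProblem in
theorem mainTheorem2 {n : ℕ} (Ω : Set (EuclideanSpace ℝ (Fin n))) (hΩ : IsOpen Ω)
    (u : EuclideanSpace ℝ (Fin n) → ℝ) (hu : IsObstacleSolution Ω u) :
    ∃ p : EuclideanSpace ℝ (Fin n) → EuclideanSpace ℝ (Fin n) → ℝ,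
      (∀ x₀ ∈ singularSet Ω u,
        p x₀ ∈ blowupPolynomials n ∧
        TendstoLocallyUniformly (fun r : ℝ => rescaling u x₀ r) (p x₀) (𝓝[>] 0) ∧
        TendstoLocallyUniformly (fun r : ℝ => fderiv ℝ (rescaling u x₀ r))
          (fderiv ℝ (p x₀)) (𝓝[>] 0)) ∧
      (∀ K : Set (EuclideanSpace ℝ (Fin n)), IsCompact K → K ⊆ Ω →
        ∀ ε : ℝ, 0 < ε → ∃ δ : ℝ, 0 < δ ∧
          ∀ x₀ ∈ singularSet Ω u ∩ K, ∀ x₁ ∈ singularSet Ω u ∩ K, dist x₀ x₁ < δ →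
            ∀ z : EuclideanSpace ℝ (Fin n), ‖z‖ ≤ 1 → |p x₀ z - p x₁ z| ≤ ε) := by
  choose! A hA htr hlim hlim' using fun x (hx : x ∈ singularSet Ω u) => exists_blowup hΩ hu hx
  refine ⟨fun x => quadraticPoly (A x), fun x hx =>
    ⟨⟨A x, hA x hx, htr x hx, rfl⟩, hlim x hx, hlim' x hx⟩, fun K hK hKΩ ε hε => ?_⟩
  -- Every point of K is treated, singular or not, so that the neighbourhoods cover K and a Lebesgue
  -- number exists.
  have hloc : ∀ x ∈ K, ∃ q : EuclideanSpace ℝ (Fin n) → ℝ, ∀ ε > 0,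
      ∀ᶠ y in 𝓝[singularSet Ω u] x, ∀ z : EuclideanSpace ℝ (Fin n), ‖z‖ ≤ 1 →
        |quadraticPoly (A y) z - q z| ≤ ε := fun x hx =>
    exists_tendsto_blowup hΩ hu (hKΩ hx) fun y hy =>
      ⟨⟨A y, hA y hy, htr y hy, rfl⟩, fun z => (hlim y hy).tendstoLocallyUniformlyOn.tendsto_at (mem_univ z)⟩
  choose! q hq using hloc
  have hnhd : ∀ x ∈ K, ∃ s ∈ 𝓝 x, ∀ y ∈ s ∩ singularSet Ω u,
      ∀ z : EuclideanSpace ℝ (Fin n), ‖z‖ ≤ 1 → |quadraticPoly (A y) z - q x z| ≤ ε / 2 :=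
    fun x hx => mem_nhdsWithin_iff_exists_mem_nhds_inter.1 (hq x hx (ε / 2) (by positivity))
  choose! s hs hsq using hnhd
  obtain ⟨δ, hδ, hcov⟩ := lebesgue_number_lemma_of_metric hK (c := fun x : K => interior (s x))
    (fun _ => isOpen_interior)
    fun x hx => mem_iUnion.2 ⟨⟨x, hx⟩, mem_interior_iff_mem_nhds.2 (hs x hx)⟩
  refine ⟨δ, hδ, fun x₀ hx₀ x₁ hx₁ hd z hz => ?_⟩
  -- Both points lie in the neighbourhood of one y, so each blow-up is within ε/2 of the same limit.
  obtain ⟨y, hy⟩ := hcov x₀ hx₀.2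
  have h0 := hsq y y.2 x₀ ⟨interior_subset (hy (Metric.mem_ball_self hδ)), hx₀.1⟩ z hz
  have h1 := hsq y y.2 x₁ 
    ⟨interior_subset (hy (by rwa [Metric.mem_ball, dist_comm])), hx₁.1⟩ z hz
  have h2 := abs_sub_le (quadraticPoly (A x₀) z) (q y z) (quadraticPoly (A x₁) z)
  rw [abs_sub_comm (q y z)] at h2
  linarith
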